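/- **Setting.** Let $g_0,\dots,g_m\in C^\infty(\mathbb R^d,\mathbb R^d)$ and $x_0\in\mathbb R^d$. Let $T$ be the set of rooted trees with vertices coloured by $0,\dots,m$ (the order of branches is irrelevant), including the empty tree $\emptyset$; $[\tau_1,\dots,\tau_\kappa]_l$ denotes the tree obtained by joining the nonempty trees $\tau_1,\dots,\tau_\kappa$ to a common root of colour $l$, and $\bullet_l$ is the one-vertex tree ($\kappa=0$). Put $F(\emptyset)(x)=x$, $F([\tau_1,\dots,\tau_\kappa]_l)(x)=g_l^{(\kappa)}(x)\big(F(\tau_1)(x),\dots,F(\tau_\kappa)(x)\big)$, and $\alpha(\emptyset)=1$, $\alpha([\tau_1,\dots,\tau_\kappa]_l)=\frac1{r_1!\cdots r_q!}\prod_j\alpha(\tau_j)$, where $r_1,\dots,r_q$ are the multiplicities of the distinct trees among the $\tau_j$. Let $\Xi$ be the ring of families $(\varphi(h))_{h\ge0}$ of real random variables. For $\phi:T\to\Xi$ the B-series is the formal series $B(\phi,x;h)=\sum_{\tau\in T}\alpha(\tau)\,\phi(\tau)(h)\,F(\tau)(x)$. Formal series are graded by the number of vertices, i.e. $g_l$ is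 replaced by $\varepsilon g_l$ with a formal parameter $\varepsilon$; a smooth function of a formal series is its Taylor expansion at the constant term. For $\tau\in T$ let $ST(\tau)$ be the set of pairs $(\vartheta,\omega)$ of a (possibly empty) subtree $\vartheta$ of $\tau$ with the same root and the multiset $\omega$ of trees left over when $\vartheta$ is removed, with $(\emptyset,\{\tau\})\in ST(\tau)$ for $\tau\neq\emptyset$ and $ST(\emptyset)=\{(\emptyset,\emptyset)\}$; let $SP(\tau)$ be the set of those pairs for which $\omega=\{\delta\}$ has exactly one element. Let $\gamma(\tau,\vartheta,\omega)$ be the number of ways in which $(\vartheta,\omega)$ arises from an ordered version of $\tau$. Recursively, $\gamma(\emptyset,\emptyset,\emptyset)=\gamma(\tau,\emptyset,\{\tau\})=1$, and for $\tau=[\tau_1,\dots,\tau_\kappa]_l$ and $\vartheta\ne\emptyset$, $$\gamma(\tau,\vartheta,\omega)=\sum_u\frac{\prod_\sigma R_\sigma!}{\prod_{t}u(t)!}\prod_{i=1}^{\kappa}\gamma(\tau_i,\vartheta_i,\omega_i),$$ where the sum is over all multisets $u=\{(\tau_1,\vartheta_1,\omega_1),\dots,(\tau_\kappa,\vartheta_\kappa,\omega_\kappa)\}$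 with $(\vartheta_i,\omega_i)\in ST(\tau_i)$, $[\vartheta_1,\dots,\vartheta_\kappa]_l=\vartheta$ (empty $\vartheta_i$ dropped) and $\omega_1+\dots+\omega_\kappa=\omega$; $R_\sigma$ is the multiplicity of $\sigma$ among the $\tau_i$, and $u(t)$ the multiplicity of the triple $t$ in $u$. For $\phi_x,\phi_y:T\to\Xi$ put $$(\phi_x\circ\phi_y)(\tau)=\sum_{(\vartheta,\omega)\in ST(\tau)}\gamma(\tau,\vartheta,\omega)\,\phi_y(\vartheta)\prod_{\delta\in\omega}\phi_x(\delta),$$ $$(\phi_x\ast\phi_y)(\emptyset)=0,\qquad(\phi_x\ast\phi_y)(\tau)=\sum_{(\vartheta,\{\delta\})\in SP(\tau)}\gamma(\tau,\vartheta,\{\delta\})\,\phi_y(\vartheta)\,\phi_x(\delta)\quad(\tau\ne\emptyset).$$ Let $\Phi_{ex},\Phi_{im},\Phi_0:T\to\Xi$ with $\Phi_{ex}(\emptyset)\equiv1$, $\Phi_{im}(\emptyset)\equiv0$, $\Phi_0(\emptyset)\equiv1$. Let $\Phi$ be the weights of the method $Y_1=B(\Phi_{ex},x_0;h)+B(\Phi_{im},Y_1;h)$,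 that is, $\Phi(\emptyset)\equiv1$ and $\Phi(\tau)=\Phi_{ex}(\tau)+(\Phi\circ\Phi_{im})(\tau)$; this recursion has exactly one solution. The modified Newton iteration is $$Y_{1,k+1}=B(\Phi_{ex},x_0;h)+B(\Phi_{im},Y_{1,k};h)+\partial_2B(\Phi_{im},x_0;h)\,(Y_{1,k+1}-Y_{1,k}),\qquad Y_{1,0}=B(\Phi_0,x_0;h).$$ **Lemma (modified Newton iteration).** 1. There is exactly one sequence of weights $\Phi_k:T\to\Xi$, $k\ge 0$, that starts with the given $\Phi_0$ and satisfies, for all $k\ge0$ and $\tau\in T$, $$\Phi_{k+1}(\emptyset)\equiv1,\qquad \Phi_{k+1}(\tau)=\Phi_{ex}(\tau)+(\Phi_k\circ\Phi_{im})(\tau)+\big((\Phi_{k+1}-\Phi_k)\ast\Phi_{im}\big)(\tau).$$ The iteration has exactly one solution in formal series, namely $Y_{1,k}=B(\Phi_k,x_0;h)$, $k\ge0$. Moreover, for fixed $h$ and a fixed outcome, vectors $Y_{1,0}=B(\Phi_0,x_0;h),Y_{1,1},\dots,Y_{1,K}\in\mathbb R^d$ satisfying the iteration are the sums of the B-series $B(\Phi_k,x_0;h)$,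 $k\le K$, provided that in every step all series involved converge and the linear equation for $Y_{1,k+1}$ has at most one solution. Here the series of the vectors $B(\Phi_{ex},x_0;h)$, $B(\Phi_k,x_0;h)$ and of the matrix $\partial_2B(\Phi_{im},x_0;h)$ are required to converge absolutely, and convergence of $B(\Phi_{im},Y_{1,k};h)$ means that each $F(\vartheta)$ with $\Phi_{im}(\vartheta)\ne0$ is represented at $Y_{1,k}$ by its Taylor series at $x_0$ and that $$\sum_{\vartheta\in T}\sum_{\kappa\ge0}\frac{|\alpha(\vartheta)\Phi_{im}(\vartheta)|}{\kappa!}\,\big\|F(\vartheta)^{(\kappa)}(x_0)\big\|\Big(\sum_{\tau\neq\emptyset}\|\alpha(\tau)\Phi_k(\tau)F(\tau)(x_0)\|\Big)^\kappa<\infty .$$ 2. Define $\mathfrak r:T\to\mathbb N$ by $\mathfrak r(\emptyset)=0$, $\mathfrak r(\bullet_l)=1$, $\mathfrak r([\tau_1]_l)=\mathfrak r(\tau_1)$, and $\mathfrak r([\tau_1,\dots,\tau_\kappa]_l)=1+\max_{j}\mathfrak r(\tau_j)$ for $\kappa\ge2$. Then $\mathfrak r$ is a growth function of the iteration: for every $k\ge0$,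 if $\Phi_k(\tau)=\Phi(\tau)$ for all $\tau$ with $\mathfrak r(\tau)\le k$, then $\Phi_{k+1}(\tau)=\Phi(\tau)$ for all $\tau$ with $\mathfrak r(\tau)\le k+1$. The same holds for each fixed $h$ and outcome. It is sharp in general: for some choice of $\Phi_{ex},\Phi_{im},\Phi_0$ as above, $\Phi_k(\tau)(h)\ne\Phi(\tau)(h)$ for all $\tau\in T$, all $k<\mathfrak r(\tau)$, all $h>0$ and all outcomes. 3. For every $\tau\neq\emptyset$, $\mathfrak r(\tau)$ is one plus the maximal number of ramifications (vertices with at least two children) along a branch (a path from the root to a leaf) of $\tau$. -/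

import Mathlib

open scoped NNReal

namespace BSeries

/-! ### Coloured rooted trees -/

/-- Finite rooted trees drawn in the plane, with vertices coloured by `C`. -/
inductive PlaneTree (C : Type) : Type
  | node (c : C) (n : ℕ) (f : Fin n → PlaneTree C) : PlaneTree C

/-- Two plane trees are isomorphic if the roots have the same colour and the branches at the root
can be matched bijectively by isomorphic ones. -/
inductive PlaneTree.Iso {C : Type} : PlaneTree C → PlaneTree C → Prop
  | node (c : C) {n m : ℕ} (f : Fin n → PlaneTree C) (g : Fin m → PlaneTree C) (e : Fin n ≃ Fin m)
      (h : ∀ i, PlaneTree.Iso (f i) (g (e i))) :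
      PlaneTree.Iso (PlaneTree.node c n f) (PlaneTree.node c m g)

theorem PlaneTree.Iso.rfl' {C : Type} (t : PlaneTree C) : t.Iso t := by
  induction t with
  | node c n f ih => exact .node c f f (Equiv.refl _) ih

theorem PlaneTree.Iso.symm' {C : Type} {s t : PlaneTree C} (h : s.Iso t) : t.Iso s := by
  induction h with
  | node c f g e h ih =>
    refine .node c g f e.symm fun i => ?_
    simpa using ih (e.symm i)

theorem PlaneTree.Iso.trans' {C : Type} {s t u : PlaneTree C} (h : s.Iso t) (h' : t.Iso u) :
    s.Iso u := by
  induction h generalizing u with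
  | node c f g e h ih =>
    cases h' with
    | node _ _ k e' h'' =>
      exact .node c f k (e.trans e') fun i => ih i (h'' (e i))

instance PlaneTree.setoid (C : Type) : Setoid (PlaneTree C) :=
  ⟨PlaneTree.Iso, ⟨PlaneTree.Iso.rfl', PlaneTree.Iso.symm', PlaneTree.Iso.trans'⟩⟩

/-- Number of vertices of a plane tree. -/
def PlaneTree.size {C : Type} : PlaneTree C → ℕ
  | .node _ _ f => 1 + ∑ i, (f i).size

/-- Nonempty rooted trees coloured by `C`, where the order of the branches is irrelevant. -/
def RTree (C : Type) : Type := Quotient (PlaneTree.setoid C)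

noncomputable instance RTree.decEq (C : Type) : DecidableEq (RTree C) := Classical.decEq _

/-- The tree represented by a plane tree. -/
def RTree.mk {C : Type} (t : PlaneTree C) : RTree C := Quotient.mk _ t

/-- The colour of the root of a plane tree. -/
def PlaneTree.root {C : Type} : PlaneTree C → C
  | .node c _ _ => c

/-- The multiset of the branches at the root of a plane tree, up to isomorphism. -/
def PlaneTree.children {C : Type} : PlaneTree C → Multiset (RTree C)
  | .node _ _ f => Finset.univ.val.map fun i => RTree.mk (f i)

/-- The colour of the root. -/
def RTree.root {C : Type} (τ : RTree C) : C :=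
  Quotient.lift PlaneTree.root (by rintro _ _ ⟨c, f, g, e, h⟩; rfl) τ

/-- The multiset of the subtrees attached to the root. -/
def RTree.children {C : Type} (τ : RTree C) : Multiset (RTree C) :=
  Quotient.lift PlaneTree.children
    (by
      rintro _ _ ⟨c, f, g, e, h⟩
      have h1 : (fun i => RTree.mk (f i)) = (fun i => RTree.mk (g i)) ∘ e :=
        funext fun i => Quotient.sound (h i)
      have h2 := congrArg Finset.val (Finset.map_univ_equiv e)
      rw [Finset.map_val] at h2
      simp only [PlaneTree.children]
      rw [h1, ← h2, Multiset.map_map]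
      rfl) τ

/-- The number of vertices. -/
def RTree.size {C : Type} (τ : RTree C) : ℕ :=
  Quotient.lift PlaneTree.size
    (by
      intro a b h
      induction h with
      | node c f g e h ih =>
        simp only [PlaneTree.size]
        rw [← Equiv.sum_comp e]
        exact congrArg _ (Finset.sum_congr rfl fun i _ => ih i)) τ

theorem RTree.size_eq {C : Type} (τ : RTree C) :
    τ.size = 1 + (τ.children.map RTree.size).sum := by
  induction τ using Quotient.inductionOn with
  | h t =>
    cases t with
    | node c n f =>
      change 1 + ∑ i, (f i).size =
        1 + ((Finset.univ.val.map fun i => RTree.mk (f i)).map RTree.size).sum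
      rw [Multiset.map_map]
      rfl

theorem RTree.size_lt {C : Type} {σ τ : RTree C} (h : σ ∈ τ.children) : σ.size < τ.size := by
  rw [τ.size_eq]
  have := Multiset.single_le_sum (fun _ _ => Nat.zero_le _) _
    (Multiset.mem_map_of_mem RTree.size h)
  omega

/-- The tree `[τ₁, …, τ_κ]_c` obtained by joining the trees of the multiset `s = {τ₁, …, τ_κ}`
to a common root of colour `c`; for `s = 0` this is the one-vertex tree `•_c = [∅]_c`. -/
noncomputable def RTree.node {C : Type} (c : C) (s : Multiset (RTree C)) : RTree C :=
  RTree.mk (PlaneTree.node c s.toList.length fun i => Quotient.out (s.toList.get i : RTree C))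

theorem RTree.root_node {C : Type} (c : C) (s : Multiset (RTree C)) :
    (RTree.node c s).root = c := rfl

theorem RTree.children_node {C : Type} (c : C) (s : Multiset (RTree C)) :
    (RTree.node c s).children = s := by
  change Finset.univ.val.map (fun i => RTree.mk (Quotient.out (s.toList.get i : RTree C))) = s
  have h : (fun i => RTree.mk (Quotient.out (s.toList.get i : RTree C))) = s.toList.get :=
    funext fun i => Quotient.out_eq _
  rw [h, Fin.univ_val_map, List.ofFn_get, Multiset.coe_toList]

theorem RTree.ext' {C : Type} {σ τ : RTree C} (h : σ.root = τ.root)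
    (h' : σ.children = τ.children) : σ = τ := by
  induction σ using Quotient.inductionOn with
  | h s =>
  induction τ using Quotient.inductionOn with
  | h t =>
  cases s with
  | node c n f =>
  cases t with
  | node d m g =>
  obtain rfl : c = d := h
  replace h' : Finset.univ.val.map (fun i => RTree.mk (f i)) =
    Finset.univ.val.map (fun i => RTree.mk (g i)) := h'
  rw [Fin.univ_val_map, Fin.univ_val_map, Multiset.coe_eq_coe] at h'
  obtain rfl : n = m := by simpa using h'.length_eq
  let e : Fin n → Fin n := fun i =>
    Fin.cast (List.length_ofFn) (h'.idxBij (Fin.cast (List.length_ofFn).symm i))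
  have he : Function.Injective e := fun i j hij => by
    have h1 := h'.idxBij_rightInverse_idxBij_symm.injective ((Fin.cast_injective _) hij)
    exact (Fin.cast_injective _) h1
  refine Quotient.sound (PlaneTree.Iso.node c f g
    (Equiv.ofBijective e (Finite.injective_iff_bijective.1 he)) fun i => ?_)
  have h2 := h'.getElem_idxBij_eq_getElem (Fin.cast (List.length_ofFn).symm i)
  rw [List.getElem_ofFn, List.getElem_ofFn] at h2
  have h3 : Quotient.mk (PlaneTree.setoid C) (f i) = Quotient.mk _ (g (e i)) := h2.symm
  exact Quotient.exact h3

theorem RTree.node_eta {C : Type} (τ : RTree C) : RTree.node τ.root τ.children = τ :=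
  RTree.ext' rfl (RTree.children_node _ _)

theorem RTree.finite_size_le (C : Type) [Finite C] (n : ℕ) :
    {τ : RTree C | τ.size ≤ n}.Finite := by
  induction n with
  | zero =>
    refine Set.finite_empty.subset fun τ hτ => ?_
    have h1 := τ.size_eq
    have h2 : τ.size ≤ 0 := hτ
    omega
  | succ n ih =>
    let M : Multiset (RTree C) := n • ih.toFinset.val
    refine ((Set.finite_univ (α := C)).prod (M.powerset.toFinset.finite_toSet)
      |>.image fun p => RTree.node p.1 p.2).subset fun τ hτ => ?_
    refine ⟨(τ.root, τ.children), ⟨trivial, ?_⟩, τ.node_eta⟩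
    have h1 : τ.size ≤ n + 1 := hτ
    have h2 := τ.size_eq
    have h3 : τ.children.card ≤ (τ.children.map RTree.size).sum := by
      have := Multiset.card_nsmul_le_sum (s := τ.children.map RTree.size) (a := 1)
        (by
          intro x hx
          obtain ⟨σ, -, rfl⟩ := Multiset.mem_map.1 hx
          have := σ.size_eq
          omega)
      simpa using this
    simp only [Finset.mem_coe, Multiset.mem_toFinset, Multiset.mem_powerset]
    refine Multiset.le_iff_count.2 fun σ => ?_
    by_cases hσ : σ ∈ τ.children
    · have h4 : σ ∈ ih.toFinset.val := by
        have := RTree.size_lt hσ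
        simp only [Finset.mem_val, Set.Finite.mem_toFinset, Set.mem_ofPred_eq]
        omega
      have h5 := Multiset.one_le_count_iff_mem.2 h4
      have h6 := Multiset.count_le_card σ τ.children
      rw [Multiset.count_nsmul]
      nlinarith
    · simp [Multiset.count_eq_zero_of_notMem hσ]

/-- The set of coloured rooted trees, including the empty tree `∅ = none`. -/
abbrev CTree (C : Type) : Type := Option (RTree C)

/-- The number of vertices of a possibly empty tree. -/
def numVertices {C : Type} (τ : CTree C) : ℕ := τ.elim 0 RTree.size

theorem finite_numVertices (C : Type) [Finite C] (n : ℕ) :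
    {τ : CTree C | numVertices τ = n}.Finite := by
  refine ((RTree.finite_size_le C n).image some |>.insert none).subset ?_
  rintro (_ | τ) hτ
  · exact Or.inl rfl
  · exact Or.inr ⟨τ, (show τ.size = n from hτ).le, rfl⟩

/-- The finite set of trees with exactly `n` vertices. -/
noncomputable def treesOfSize (C : Type) [Finite C] (n : ℕ) : Finset (CTree C) :=
  (finite_numVertices C n).toFinset

/-! ### Elementary differentials and the coefficients `α` -/

/-- `α([τ₁, …, τ_κ]_l) = (∏ α(τ_j)) / (r₁! ⋯ r_q!)`, where the `r_i` are the multiplicities of the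
distinct trees among `τ₁, …, τ_κ`. -/
noncomputable def RTree.alpha {C : Type} (τ : RTree C) : ℚ :=
  (∏ σ ∈ τ.children.toFinset, ((τ.children.count σ).factorial : ℚ))⁻¹ *
    (τ.children.attach.map fun σ => σ.1.alpha).prod
  termination_by τ.size
  decreasing_by exact RTree.size_lt σ.2

/-- The coefficient `α`, with `α(∅) = 1`. -/
noncomputable def alpha {C : Type} (τ : CTree C) : ℚ := τ.elim 1 RTree.alpha

/-- The elementary differential `F(τ)(x) = g_l^{(κ)}(x) (F(τ₁)(x), …, F(τ_κ)(x))` of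
`τ = [τ₁, …, τ_κ]_l`. The branches are enumerated in an arbitrary order, on which the value does
not depend for smooth `g_l`, because higher derivatives are symmetric. -/
noncomputable def RTree.elemDiff {C E : Type} [NormedAddCommGroup E] [NormedSpace ℝ E]
    (g : C → E → E) (τ : RTree C) (x : E) : E :=
  iteratedFDeriv ℝ τ.children.toList.length (g τ.root) x
    fun i => (τ.children.toList.get i).elemDiff g x
  termination_by τ.size
  decreasing_by exact RTree.size_lt (Multiset.mem_toList.1 (List.get_mem _ _))

/-- The elementary differential of a possibly empty tree, with `F(∅)(x) = x`. -/
noncomputable def elemDiff {C E : Type} [NormedAddCommGroup E] [NormedSpace ℝ E]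
    (g : C → E → E) (τ : CTree C) (x : E) : E :=
  τ.elim x fun σ => σ.elemDiff g x

/-! ### Subtrees with remainders and the products `∘` and `∗` -/

/-- A triple `(τ, ϑ, ω)` of a nonempty tree, a (possibly empty) subtree `ϑ` with the same root, and
the multiset `ω` of the trees left over when `ϑ` is removed from `τ`. -/
abbrev Triple (C : Type) : Type := RTree C × CTree C × Multiset (RTree C)

/-- The multiset `u = {(τ₁, ϑ₁, ω₁), …, (τ_κ, ϑ_κ, ω_κ)}` of triples yields the subtree
`[ϑ₁, …, ϑ_κ]_c`, where empty `ϑ_i` are dropped. -/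
noncomputable def joinSubtrees {C : Type} (c : C) (u : Multiset (Triple C)) : RTree C :=
  RTree.node c (u.filterMap fun x => x.2.1)

/-- The joint remainder `ω₁ + ⋯ + ω_κ` of `u = {(τ₁, ϑ₁, ω₁), …, (τ_κ, ϑ_κ, ω_κ)}`. -/
def joinRemainders {C : Type} (u : Multiset (Triple C)) : Multiset (RTree C) :=
  (u.map fun x => x.2.2).sum

/-- `ST(τ)` for nonempty `τ = [τ₁, …, τ_κ]_l`: the pair `(∅, {τ})`, and all pairs
`([ϑ₁, …, ϑ_κ]_l, ω₁ + ⋯ + ω_κ)` with `(ϑ_i, ω_i) ∈ ST(τ_i)`. -/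
noncomputable def RTree.ST {C : Type} (τ : RTree C) :
    Finset (CTree C × Multiset (RTree C)) :=
  insert (none, {τ})
    ((Multiset.Sections (τ.children.attach.map fun σ =>
        σ.1.ST.val.map fun p => ((σ.1, p) : Triple C))).toFinset.image
      fun u => (some (joinSubtrees τ.root u), joinRemainders u))
  termination_by τ.size
  decreasing_by exact RTree.size_lt σ.2

/-- `ST(τ)` for a possibly empty tree, with `ST(∅) = {(∅, ∅)}`. -/
noncomputable def ST {C : Type} (τ : CTree C) : Finset (CTree C × Multiset (RTree C)) :=
  τ.elim {(none, 0)} RTree.ST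

/-- All multisets `{(τ₁, ϑ₁, ω₁), …, (τ_κ, ϑ_κ, ω_κ)}` with `(ϑ_i, ω_i) ∈ ST(τ_i)`, where
`τ₁, …, τ_κ` are the branches of `τ`. -/
noncomputable def RTree.splittings {C : Type} (τ : RTree C) : Finset (Multiset (Triple C)) :=
  (Multiset.Sections (τ.children.map fun σ =>
    σ.ST.val.map fun p => ((σ, p) : Triple C))).toFinset

/-- The combinatorial coefficient `γ(τ, ϑ, ω)` for nonempty `τ = [τ₁, …, τ_κ]_l`: it is
`γ(τ, ∅, {τ}) = 1`, and for nonempty `ϑ` it is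
`(R₁! ⋯ R_Q! / ∏ (multiplicities of the distinct triples)!) * ∏ γ(τ_i, ϑ_i, ω_i)`,
where the `R_i` are the multiplicities of the distinct branches of `τ`.
A triple `(τ, ϑ, ω)` may arise from several multisets `{(τ₁, ϑ₁, ω₁), …, (τ_κ, ϑ_κ, ω_κ)}`;
their contributions are added up, so that `γ(τ, ϑ, ω)` is the number of ways in which `ϑ` with
remainder `ω` occurs in an ordered version of `τ`.
(The condition in the innermost `if` holds for all the triples that occur.) -/
noncomputable def RTree.gamma {C : Type} (τ : RTree C) (ϑ : CTree C) (ω : Multiset (RTree C)) : ℚ :=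
  match ϑ with
  | none => if ω = {τ} then 1 else 0
  | some η =>
    ∑ u ∈ τ.splittings with joinSubtrees τ.root u = η ∧ joinRemainders u = ω,
      (∏ σ ∈ τ.children.toFinset, ((τ.children.count σ).factorial : ℚ)) /
        (∏ x ∈ u.toFinset, ((u.count x).factorial : ℚ)) *
        (u.map fun x => if x.1 ∈ τ.children then x.1.gamma x.2.1 x.2.2 else 0).prod
  termination_by τ.size
  decreasing_by exact RTree.size_lt ‹_›

/-- The coefficient `γ` for a possibly empty tree, with `γ(∅, ∅, ∅) = 1`. -/
noncomputable def gamma {C : Type} (τ ϑ : CTree C) (ω : Multiset (RTree C)) : ℚ :=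
  τ.elim (if ϑ = none ∧ ω = 0 then 1 else 0) fun σ => σ.gamma ϑ ω

/-- The composition
`(φx ∘ φy)(τ) = ∑_{(ϑ, ω) ∈ ST(τ)} γ(τ, ϑ, ω) φy(ϑ) ∏_{δ ∈ ω} φx(δ)` of weights. -/
noncomputable def compose {C : Type} {R : Type*} [CommRing R] [Algebra ℚ R] (φx φy : CTree C → R)
    (τ : CTree C) : R :=
  ∑ p ∈ ST τ, gamma τ p.1 p.2 • (φy p.1 * (p.2.map fun δ => φx (some δ)).prod)

/-- `SP(τ)`: the pairs in `ST(τ)` whose remainder consists of exactly one tree. -/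
noncomputable def SP {C : Type} (τ : CTree C) : Finset (CTree C × Multiset (RTree C)) :=
  (ST τ).filter fun p => p.2.card = 1

/-- The bilinear product `(φx ∗ φy)(∅) = 0` and
`(φx ∗ φy)(τ) = ∑_{(ϑ, {δ}) ∈ SP(τ)} γ(τ, ϑ, {δ}) φy(ϑ) φx(δ)` for `τ ≠ ∅`. -/
noncomputable def starProd {C : Type} {R : Type*} [CommRing R] [Algebra ℚ R] (φx φy : CTree C → R)
    (τ : CTree C) : R :=
  if τ = none then 0
  else ∑ p ∈ SP τ, gamma τ p.1 p.2 • (φy p.1 * (p.2.map fun δ => φx (some δ)).sum)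

/-- The weights `Ξ`: families `(φ(h))_{h ≥ 0}` of real random variables. -/
def Xi (Ω : Type*) [MeasurableSpace Ω] : Subalgebra ℝ (ℝ≥0 → Ω → ℝ) where
  carrier := {φ | ∀ h, Measurable (φ h)}
  mul_mem' ha hb h := (ha h).mul (hb h)
  add_mem' ha hb h := (ha h).add (hb h)
  algebraMap_mem' _ _ := measurable_const

/-- The real weights obtained from `φ : T → Ξ` by fixing the step size `h` and the outcome `ω`. -/
def path {C : Type} {Ω : Type*} [MeasurableSpace Ω] (φ : CTree C → Xi Ω) (h : ℝ≥0) (ω : Ω)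
    (τ : CTree C) : ℝ :=
  (φ τ).1 h ω

/-! ### Formal B-series

Replacing all `g_l` by `ε g_l` multiplies `F(τ)` by `ε ^ n`, where `n` is the number of vertices of
`τ`. Formal series are graded accordingly: a formal series `∑ εⁿ Y_n` with coefficients in `E` is
the sequence `Y : ℕ → E`. -/

/-- The B-series `B(φ, x₀) = ∑_τ α(τ) φ(τ) F(τ)(x₀)`, for `φ` evaluated at a fixed step size and
outcome, as a formal series: the coefficient at `n` collects the trees with `n` vertices. -/
noncomputable def bseries {C E : Type} [Finite C] [NormedAddCommGroup E] [NormedSpace ℝ E]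
    (g : C → E → E) (φ : CTree C → ℝ) (x₀ : E) : ℕ → E :=
  fun n => ∑ τ ∈ treesOfSize C n, ((alpha τ : ℝ) * φ τ) • elemDiff g τ x₀

/-- A smooth function `f` evaluated at a formal series `Y`, by Taylor expansion at `Y 0`:
`∑_κ (1 / κ!) f^{(κ)}(Y 0) (Y - Y 0, …, Y - Y 0)`, sorted by degree. -/
noncomputable def formalEval {E : Type} [NormedAddCommGroup E] [NormedSpace ℝ E]
    (f : E → E) (Y : ℕ → E) : ℕ → E :=
  fun n => ∑ c : Composition n, ((c.length.factorial : ℝ))⁻¹ •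
    iteratedFDeriv ℝ c.length f (Y 0) fun i => Y (c.blocksFun i)

/-- The B-series `B(φ, Y) = ∑_τ α(τ) φ(τ) F(τ)(Y)` at a formal series `Y`. -/
noncomputable def bseriesAt {C E : Type} [Finite C] [NormedAddCommGroup E] [NormedSpace ℝ E]
    (g : C → E → E) (φ : CTree C → ℝ) (Y : ℕ → E) : ℕ → E :=
  fun n => ∑ p ∈ Finset.HasAntidiagonal.antidiagonal n, ∑ τ ∈ treesOfSize C p.1,
    ((alpha τ : ℝ) * φ τ) • formalEval (elemDiff g τ) Y p.2

/-- The Jacobian `∂₂B(φ, x₀) = ∑_τ α(τ) φ(τ) F(τ)'(x₀)`, applied to a formal series `V`. -/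
noncomputable def jacobianApply {C E : Type} [Finite C] [NormedAddCommGroup E] [NormedSpace ℝ E]
    (g : C → E → E) (φ : CTree C → ℝ) (x₀ : E) (V : ℕ → E) : ℕ → E :=
  fun n => ∑ p ∈ Finset.HasAntidiagonal.antidiagonal n, ∑ τ ∈ treesOfSize C p.1,
    ((alpha τ : ℝ) * φ τ) • fderiv ℝ (elemDiff g τ) x₀ (V p.2)

/-- One step `Y' = B(φex, x₀) + B(φim, Y) + ∂₂B(φim, x₀) (Y' - Y)` of the modified Newton
iteration, for formal series. -/
def IsFormalNewtonStep {C E : Type} [Finite C] [NormedAddCommGroup E] [NormedSpace ℝ E]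
    (g : C → E → E) (φex φim : CTree C → ℝ) (x₀ : E) (Y Y' : ℕ → E) : Prop :=
  Y' = bseries g φex x₀ + bseriesAt g φim Y + jacobianApply g φim x₀ (Y' - Y)

/-! ### Convergent B-series -/

/-- The term of `B(φ, x)` that belongs to the tree `τ`. -/
noncomputable def bterm {C E : Type} [NormedAddCommGroup E] [NormedSpace ℝ E]
    (g : C → E → E) (φ : CTree C → ℝ) (x : E) (τ : CTree C) : E :=
  ((alpha τ : ℝ) * φ τ) • elemDiff g τ x

/-- The term of the Jacobian `∂₂B(φ, x)` that belongs to the tree `τ`. -/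
noncomputable def jterm {C E : Type} [NormedAddCommGroup E] [NormedSpace ℝ E]
    (g : C → E → E) (φ : CTree C → ℝ) (x : E) (τ : CTree C) : E →L[ℝ] E :=
  ((alpha τ : ℝ) * φ τ) • fderiv ℝ (elemDiff g τ) x

/-- One step `y' = B(φex, x₀) + B(φim, y) + ∂₂B(φim, x₀) (y' - y)` of the modified Newton
iteration, for vectors. -/
def IsNewtonStep {C E : Type} [NormedAddCommGroup E] [NormedSpace ℝ E]
    (g : C → E → E) (φex φim : CTree C → ℝ) (x₀ y y' : E) : Prop :=
  y' = ∑' τ, bterm g φex x₀ τ + ∑' τ, bterm g φim y τ + (∑' τ, jterm g φim x₀ τ) (y' - y)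

/-- All series in a step of the modified Newton iteration from `y = B(φ, x₀)` to `B(φ', x₀)`
converge, and the equation for the new iterate has at most one solution. -/
structure ConvergentStep {C E : Type} [NormedAddCommGroup E] [NormedSpace ℝ E]
    (g : C → E → E) (φex φim φ φ' : CTree C → ℝ) (x₀ y : E) : Prop where
  /-- `B(φex, x₀)` converges. -/
  explicit_part : Summable (bterm g φex x₀)
  /-- `B(φ, x₀)` converges. -/
  current : Summable (bterm g φ x₀)
  /-- `B(φ', x₀)` converges. -/
  next : Summable (bterm g φ' x₀)
  /-- The series of the Jacobian `∂₂B(φim, x₀)` converges. -/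
  jacobian : Summable (jterm g φim x₀)
  /-- The elementary differentials in `B(φim, y)` are represented at `y` by their Taylor series. -/
  taylor : ∀ ϑ, φim ϑ ≠ 0 → HasSum
    (fun κ : ℕ => ((κ.factorial : ℝ))⁻¹ •
      iteratedFDeriv ℝ κ (elemDiff g ϑ) x₀ fun _ => y - x₀) (elemDiff g ϑ y)
  /-- `B(φim, B(φ, x₀))` converges absolutely when expanded at `x₀`. -/
  composite : Summable fun p : CTree C × ℕ =>
    |(alpha p.1 : ℝ) * φim p.1| * ((p.2.factorial : ℝ))⁻¹ *
      ‖iteratedFDeriv ℝ p.2 (elemDiff g p.1) x₀‖ *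
        (∑' σ : RTree C, ‖bterm g φ x₀ (some σ)‖) ^ p.2
  /-- The linear equation for the new iterate has at most one solution. -/
  unique_solution : ∀ v : E, (∑' τ, jterm g φim x₀ τ) v = v → v = 0

/-! ### Weights of the method and of the iterates, growth functions -/

/-- The recursion `Φ(∅) = 1`, `Φ = Φex + Φ ∘ Φim` for the weights `Φ` of the method
`Y₁ = B(Φex, x₀) + B(Φim, Y₁)`. -/
def IsMethodWeights {C : Type} {R : Type*} [CommRing R] [Algebra ℚ R]
    (Φex Φim Φ : CTree C → R) : Prop :=
  Φ none = 1 ∧ ∀ τ, Φ τ = Φex τ + compose Φ Φim τ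

/-- The recursion `Φ_{k+1}(∅) = 1`, `Φ_{k+1} = Φex + Φ_k ∘ Φim + (Φ_{k+1} - Φ_k) ∗ Φim`, started at
the weights `Φ₀` of the predictor. -/
def IsModifiedNewtonWeights {C : Type} {R : Type*} [CommRing R] [Algebra ℚ R]
    (Φex Φim Φ₀ : CTree C → R) (Φk : ℕ → CTree C → R) : Prop :=
  Φk 0 = Φ₀ ∧ ∀ k, Φk (k + 1) none = 1 ∧
    ∀ τ, Φk (k + 1) τ =
      Φex τ + compose (Φk k) Φim τ + starProd (Φk (k + 1) - Φk k) Φim τ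

/-- `𝔤` is a growth function for iterates with weights `Φk` of a method with weights `Φ`. -/
def IsGrowthFunction {C : Type} {R : Type*} (𝔤 : CTree C → ℕ) (Φk : ℕ → CTree C → R)
    (Φ : CTree C → R) : Prop :=
  ∀ k, (∀ τ, 𝔤 τ ≤ k → Φk k τ = Φ τ) → ∀ τ, 𝔤 τ ≤ k + 1 → Φk (k + 1) τ = Φ τ

/-- The function `𝔯` on nonempty trees: `𝔯(•_l) = 1`, `𝔯([τ₁]_l) = 𝔯(τ₁)`, and
`𝔯([τ₁, …, τ_κ]_l) = 1 + max 𝔯(τ_j)` for `κ ≥ 2`. -/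
def RTree.ram {C : Type} (τ : RTree C) : ℕ :=
  if τ.children.card = 0 then 1
  else if τ.children.card = 1 then (τ.children.attach.map fun σ => σ.1.ram).sup
  else 1 + (τ.children.attach.map fun σ => σ.1.ram).sup
  termination_by τ.size
  decreasing_by all_goals exact RTree.size_lt σ.2

/-- The function `𝔯`, with `𝔯(∅) = 0`. -/
def ram {C : Type} (τ : CTree C) : ℕ := τ.elim 0 RTree.ram

/-- `b` is a branch of `τ`: a path from the root to a leaf. Each vertex on the path is given
as the subtree of its descendants. -/
inductive IsBranch {C : Type} : RTree C → List (RTree C) → Prop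
  | leaf (τ : RTree C) (h : τ.children = 0) : IsBranch τ [τ]
  | cons (τ σ : RTree C) (b : List (RTree C)) (h : σ ∈ τ.children) (hb : IsBranch σ b) :
      IsBranch τ (τ :: b)

/-- The number of ramifications along a path: of its vertices with at least two branches. -/
def ramifications {C : Type} (b : List (RTree C)) : ℕ :=
  b.countP fun σ => 2 ≤ σ.children.card

end BSeries

open BSeries

/-!
The weights are defined by recursion on the number of vertices: in `φ_x ∘ φ_y` and in `φ_x ∗ φ_y`
with `φ_y(∅) = 0` only proper parts of `τ` are inserted into `φ_x`, so both recursions have exactly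
one solution.

**Formal series.** Along the curve `y(ε) = x₀ + ∑ ε^|δ| α(δ) φ(δ) F(δ)(x₀)`, truncated at some
order, the elementary differentials obey `F([τ₁, …]_l)(y) = g_l^{(κ)}(y)(F(τ₁)(y), …)`. Expanding
every factor by Taylor's theorem and collecting equal terms by the multinomial theorem shows by
induction on `ϑ` that `α(ϑ) F(ϑ)(y(ε))` is, up to a high power of `ε`, the sum of
`α(τ) γ(τ, ϑ, ω) ∏_{δ ∈ ω} φ(δ) F(τ)(x₀) ε^(|τ| - |ϑ|)` over all trees `τ` with a splitting
`(ϑ, ω)` (`elemDiff_sub_termSum_isBigO`). The recursion for `γ` is the one satisfied by these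
coefficients. Comparing powers of `ε` gives `B(φ_y, B(φ_x, x₀)) = B(φ_x ∘ φ_y, x₀)`
(`bseriesAt_bseries`), and the part linear in `φ_x` gives
`∂₂B(φ_y, x₀) B(φ_x, x₀) = B(φ_x ∗ φ_y, x₀)` (`jacobianApply_bseries`). Hence the B-series of the
weights `Φ_k` solve the iteration. As `Φ_im(∅) = 0`, the Jacobian `∂₂B(Φ_im, x₀)` raises the degree,
so that each step has only one formal solution (`formalNewton_iff`).

**Convergent series.** Under the absolute convergence that is required, all sums may be rearranged
by degree. The sum of the formal solution then satisfies the same linear equation as the vector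
`Y_{1,k+1}`, and this equation has at most one solution (`hasSum_newtonStep`).

**Growth.** In `Φ_{k+1}(τ) - Φ(τ)` the splittings with exactly one leftover tree cancel against the
Jacobian term, apart from the difference `Φ_{k+1} - Φ` on that smaller tree. A splitting with at
least two leftover trees and nonempty `ϑ` passes through a ramification of `τ`, so that the leftover
trees `δ` have `ram δ < ram τ` (`isGrowthFunction_ram`). The implicit Euler method with constant
predictor attains this bound, since there `Φ_k(τ)` vanishes as long as `k < ram τ`, while `Φ(τ)`
does not (`newtonWeights_euler`, `methodWeights_euler`).
-/

namespace BSeries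

/-! ### Splittings of a tree -/

theorem mem_sections_map {α κ : Type*} {key : α → κ} {A : κ → Multiset α}
    (hA : ∀ k, ∀ a ∈ A k, key a = k) (U : Multiset κ) (u : Multiset α) :
    u ∈ Multiset.Sections (U.map A) ↔ u.map key = U ∧ ∀ a ∈ u, a ∈ A (key a) := by
  rw [Multiset.mem_sections, Multiset.rel_map_left]
  constructor
  · intro h
    induction h with
    | zero => simp
    | @cons k a U u hk _ ih =>
      obtain rfl := hA _ _ hk
      refine ⟨by rw [Multiset.map_cons, ih.1], fun b hb => ?_⟩
      rcases Multiset.mem_cons.1 hb with rfl | hb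
      exacts [hk, ih.2 b hb]
  · rintro ⟨rfl, h⟩
    rw [Multiset.rel_map_left]
    exact Multiset.rel_refl_of_refl_on h

variable {C : Type}

theorem RTree.mem_splittings {τ : RTree C} {u : Multiset (Triple C)} :
    u ∈ τ.splittings ↔ u.map Prod.fst = τ.children ∧ ∀ t ∈ u, t.2 ∈ t.1.ST := by
  rw [RTree.splittings, Multiset.mem_toFinset,
    mem_sections_map (key := (Prod.fst : Triple C → RTree C))]
  · refine and_congr_right fun _ => forall₂_congr fun t _ => ?_
    rcases t with ⟨σ, p⟩
    simp
  · intro k a ha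
    obtain ⟨p, _, rfl⟩ := Multiset.mem_map.1 ha
    rfl

theorem RTree.ST_eq (τ : RTree C) :
    τ.ST = insert (none, {τ})
      (τ.splittings.image fun u => (some (joinSubtrees τ.root u), joinRemainders u)) := by
  rw [RTree.ST, RTree.splittings]
  congr 4
  exact Multiset.attach_map_val' τ.children fun σ => σ.ST.val.map fun p => ((σ, p) : Triple C)

theorem RTree.mem_ST_none {τ : RTree C} {ω : Multiset (RTree C)} :
    (none, ω) ∈ τ.ST ↔ ω = {τ} := by
  rw [RTree.ST_eq]; simp

theorem RTree.mem_ST_some {τ : RTree C} {η : RTree C} {ω : Multiset (RTree C)} :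
    (some η, ω) ∈ τ.ST ↔
      ∃ u ∈ τ.splittings, joinSubtrees τ.root u = η ∧ joinRemainders u = ω := by
  rw [RTree.ST_eq]; simp

/-- The product of the factorials of the multiplicities of the distinct elements. -/
noncomputable def multFactorial {α : Type*} [DecidableEq α] (s : Multiset α) : ℚ :=
  ∏ x ∈ s.toFinset, ((s.count x).factorial : ℚ)

theorem multFactorial_pos {α : Type*} [DecidableEq α] (s : Multiset α) : 0 < multFactorial s :=
  Finset.prod_pos fun _ _ => by positivity

theorem multFactorial_ne_zero {α : Type*} [DecidableEq α] (s : Multiset α) :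
    multFactorial s ≠ 0 := (multFactorial_pos s).ne'

theorem multFactorial_eq_prod {α : Type*} [DecidableEq α] (s : Multiset α) {t : Finset α}
    (h : s.toFinset ⊆ t) : multFactorial s = ∏ x ∈ t, ((s.count x).factorial : ℚ) := by
  refine Finset.prod_subset h fun x _ hx => ?_
  rw [Multiset.mem_toFinset] at hx
  simp [Multiset.count_eq_zero_of_notMem hx]

theorem multFactorial_zero {α : Type*} [DecidableEq α] : multFactorial (0 : Multiset α) = 1 := by
  simp [multFactorial]

theorem multFactorial_cons {α : Type*} [DecidableEq α] (a : α) (s : Multiset α) :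
    multFactorial (a ::ₘ s) = (s.count a + 1) * multFactorial s := by
  rw [multFactorial_eq_prod s (t := (a ::ₘ s).toFinset) (by
      rw [Multiset.toFinset_cons]; exact Finset.subset_insert _ _),
    multFactorial, ← Finset.mul_prod_erase _ _ (show a ∈ (a ::ₘ s).toFinset by simp),
    ← Finset.mul_prod_erase _ _ (show a ∈ (a ::ₘ s).toFinset by simp), Multiset.count_cons_self,
    Nat.factorial_succ]
  have : ∀ x ∈ (a ::ₘ s).toFinset.erase a,
      (((a ::ₘ s).count x).factorial : ℚ) = ((s.count x).factorial : ℚ) := fun x hx => by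
    rw [Multiset.count_cons_of_ne (Finset.ne_of_mem_erase hx)]
  rw [Finset.prod_congr rfl this]
  push_cast
  ring

theorem multFactorial_map {α β : Type*} [DecidableEq α] [DecidableEq β] {f : α → β}
    (hf : Function.Injective f) (s : Multiset α) : multFactorial (s.map f) = multFactorial s := by
  induction s using Multiset.induction_on with
  | empty => simp [multFactorial]
  | cons a s ih =>
    rw [Multiset.map_cons, multFactorial_cons, multFactorial_cons, ih,
      Multiset.count_map_eq_count' f s hf]

theorem RTree.alpha_eq (τ : RTree C) :
    τ.alpha = (multFactorial τ.children)⁻¹ * (τ.children.map RTree.alpha).prod := by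
  rw [RTree.alpha, Multiset.attach_map_val' τ.children RTree.alpha, multFactorial]

/-- `γ` of a triple. -/
noncomputable def Triple.gamma (t : Triple C) : ℚ := t.1.gamma t.2.1 t.2.2

theorem RTree.gamma_none (τ : RTree C) : τ.gamma none {τ} = 1 := by
  rw [RTree.gamma]; simp

theorem RTree.gamma_some (τ η : RTree C) (ω : Multiset (RTree C)) :
    τ.gamma (some η) ω =
      ∑ u ∈ τ.splittings with joinSubtrees τ.root u = η ∧ joinRemainders u = ω,
        multFactorial τ.children / multFactorial u * (u.map Triple.gamma).prod := by
  rw [RTree.gamma]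
  refine Finset.sum_congr rfl fun u hu => ?_
  have h := (RTree.mem_splittings.1 (Finset.mem_filter.1 hu).1).1
  rw [multFactorial, multFactorial]
  congr 2
  refine Multiset.map_congr rfl fun t ht => ?_
  rw [if_pos (h ▸ Multiset.mem_map_of_mem _ ht)]
  rfl

/-- A sum over `ST(τ)` weighted by `γ`, resolved into the splittings of the branches of `τ`. -/
theorem RTree.sum_ST_gamma_smul {M : Type*} [AddCommGroup M] [Module ℚ M] (τ : RTree C)
    (f : CTree C × Multiset (RTree C) → M) :
    ∑ p ∈ τ.ST, τ.gamma p.1 p.2 • f p = f (none, {τ}) +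
      ∑ u ∈ τ.splittings, (multFactorial τ.children / multFactorial u *
        (u.map Triple.gamma).prod) • f (some (joinSubtrees τ.root u), joinRemainders u) := by
  rw [RTree.ST_eq, Finset.sum_insert (by simp), RTree.gamma_none, one_smul]
  congr 1
  rw [← Finset.sum_fiberwise_of_maps_to (s := τ.splittings)
    (g := fun u => (some (joinSubtrees τ.root u), joinRemainders u)) (t := τ.splittings.image
      fun u => (some (joinSubtrees τ.root u), joinRemainders u))
      (fun u hu => Finset.mem_image_of_mem _ hu)]
  refine Finset.sum_congr rfl fun p hp => ?_
  obtain ⟨u, -, rfl⟩ := Finset.mem_image.1 hp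
  rw [RTree.gamma_some, Finset.sum_smul]
  refine Finset.sum_congr (by ext; simp) fun v hv => ?_
  have h := (Finset.mem_filter.1 hv).2
  simp only [Prod.mk.injEq, Option.some.injEq] at h
  rw [h.1, h.2]

theorem joinSubtrees_children (c : C) (u : Multiset (Triple C)) :
    (joinSubtrees c u).children = u.filterMap fun x => x.2.1 := RTree.children_node _ _

theorem size_joinSubtrees (c : C) (u : Multiset (Triple C)) :
    (joinSubtrees c u).size = 1 + (u.map fun t => numVertices t.2.1).sum := by
  rw [RTree.size_eq, joinSubtrees_children]
  congr 1
  induction u using Multiset.induction_on with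
  | empty => simp
  | cons t u ih =>
    rcases t with ⟨σ, _ | ϑ, ω⟩
    · rw [Multiset.filterMap_cons_none _ _ rfl, ih]
      simp [numVertices]
    · rw [Multiset.filterMap_cons_some (fun x : Triple C => x.2.1) _ _ (b := ϑ) rfl]
      simp [ih, numVertices]

theorem joinRemainders_cons (t : Triple C) (u : Multiset (Triple C)) :
    joinRemainders (t ::ₘ u) = t.2.2 + joinRemainders u := by
  simp [joinRemainders]

@[to_additive]
theorem prod_map_joinRemainders {M : Type*} [CommMonoid M] (f : RTree C → M)
    (u : Multiset (Triple C)) :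
    ((joinRemainders u).map f).prod = (u.map fun t => (t.2.2.map f).prod).prod := by
  induction u using Multiset.induction_on with
  | empty => simp [joinRemainders]
  | cons t u ih => simp [joinRemainders_cons, ih]

/-- The vertices of `τ` are those of the subtree `ϑ` and those of the trees left over. -/
theorem RTree.numVertices_add_of_mem_ST {τ : RTree C} {p : CTree C × Multiset (RTree C)}
    (hp : p ∈ τ.ST) : numVertices p.1 + (p.2.map RTree.size).sum = τ.size := by
  induction h : τ.size using Nat.strong_induction_on generalizing τ p with
  | _ n ih =>
    subst h
    rcases p with ⟨_ | η, ω⟩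
    · rw [RTree.mem_ST_none] at hp
      simp [hp, numVertices]
    · obtain ⟨u, hu, rfl, rfl⟩ := RTree.mem_ST_some.1 hp
      obtain ⟨h1, h2⟩ := RTree.mem_splittings.1 hu
      have h3 : (u.map fun t => numVertices t.2.1 + (t.2.2.map RTree.size).sum) =
          u.map fun t => t.1.size := Multiset.map_congr rfl fun t ht =>
        ih _ (RTree.size_lt (h1 ▸ Multiset.mem_map_of_mem _ ht)) (h2 t ht) rfl
      rw [sum_map_joinRemainders, τ.size_eq, ← h1, Multiset.map_map]
      change (joinSubtrees τ.root u).size + _ = 1 + (u.map fun t => t.1.size).sum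
      rw [size_joinSubtrees, ← h3, Multiset.sum_map_add]
      ring

theorem RTree.size_pos (τ : RTree C) : 0 < τ.size := by rw [τ.size_eq]; omega

theorem RTree.size_lt_of_mem_ST {τ η δ : RTree C} {ω : Multiset (RTree C)}
    (h : (some η, ω) ∈ τ.ST) (hδ : δ ∈ ω) : δ.size < τ.size := by
  have h1 := RTree.numVertices_add_of_mem_ST h
  have h2 := Multiset.single_le_sum (fun _ _ => Nat.zero_le _) _
    (Multiset.mem_map_of_mem RTree.size hδ)
  have := η.size_pos
  simp only [numVertices, Option.elim_some] at h1
  omega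

/-! ### The recursions for the weights -/

section Weights

variable {R : Type*} [CommRing R] [Algebra ℚ R]

theorem compose_none (φ ψ : CTree C → R) : compose φ ψ none = ψ none := by
  simp [compose, ST, gamma]

theorem starProd_none (φ ψ : CTree C → R) : starProd φ ψ none = 0 := if_pos rfl

theorem starProd_some (φ ψ : CTree C → R) (τ : RTree C) :
    starProd φ ψ (some τ) = ∑ p ∈ τ.ST, τ.gamma p.1 p.2 •
      (if p.2.card = 1 then ψ p.1 * (p.2.map fun δ => φ (some δ)).sum else 0) := by
  rw [starProd, if_neg (Option.some_ne_none τ), SP, Finset.sum_filter]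
  refine Finset.sum_congr rfl fun p _ => ?_
  split_ifs <;> simp [gamma]

theorem compose_congr {φ φ' ψ : CTree C → R} (hψ : ψ none = 0) {τ : CTree C}
    (h : ∀ σ, numVertices σ < numVertices τ → φ σ = φ' σ) :
    compose φ ψ τ = compose φ' ψ τ := by
  rcases τ with _ | τ
  · simp [compose_none]
  · refine Finset.sum_congr rfl fun p hp => ?_
    rcases p with ⟨_ | η, ω⟩
    · simp [hψ]
    · congr 3
      exact Multiset.map_congr rfl fun δ hδ => h _ (RTree.size_lt_of_mem_ST hp hδ)

theorem starProd_congr {φ φ' ψ : CTree C → R} (hψ : ψ none = 0) {τ : CTree C}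
    (h : ∀ σ, numVertices σ < numVertices τ → φ σ = φ' σ) :
    starProd φ ψ τ = starProd φ' ψ τ := by
  rcases τ with _ | τ
  · simp [starProd_none]
  · rw [starProd_some, starProd_some]
    refine Finset.sum_congr rfl fun p hp => ?_
    rcases p with ⟨_ | η, ω⟩
    · simp [hψ]
    · congr 4
      exact Multiset.map_congr rfl fun δ hδ => h _ (RTree.size_lt_of_mem_ST hp hδ)

/-- A recursion that expresses the weight of a tree by the weights of smaller trees has exactly
one solution. -/
theorem existsUnique_weights {S : Type*} [Zero S] (T : (CTree C → S) → CTree C → S)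
    (hT : ∀ φ φ' τ, (∀ σ, numVertices σ < numVertices τ → φ σ = φ' σ) → T φ τ = T φ' τ) :
    ∃! φ, ∀ τ, φ τ = T φ τ := by
  classical
  let wf := (measure (numVertices (C := C))).wf
  let φ : CTree C → S := wf.fix fun τ rec =>
    T (fun σ => if h : numVertices σ < numVertices τ then rec σ h else 0) τ
  have hφ : ∀ τ, φ τ = T φ τ := fun τ => by
    change wf.fix _ τ = _
    rw [wf.fix_eq]
    refine hT _ _ _ fun σ hσ => ?_
    rw [dif_pos hσ]
  refine ⟨φ, hφ, fun φ' h' => funext fun τ => ?_⟩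
  induction h : numVertices τ using Nat.strong_induction_on generalizing τ with
  | _ n ih =>
    subst h
    rw [h' τ, hφ τ]
    exact hT _ _ _ fun σ hσ => ih _ hσ σ rfl

theorem existsUnique_methodWeights {Φex Φim : CTree C → R} (hex : Φex none = 1)
    (him : Φim none = 0) : ∃! Φ, IsMethodWeights Φex Φim Φ := by
  obtain ⟨Φ, h, hu⟩ := existsUnique_weights (fun φ τ => Φex τ + compose φ Φim τ)
    fun φ φ' τ hφ => by rw [compose_congr him hφ]
  refine ⟨Φ, ⟨by rw [h none]; simp [compose_none, hex, him], h⟩, fun Φ' h' => hu _ h'.2⟩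

theorem existsUnique_newtonStep {Φex Φim : CTree C → R} (hex : Φex none = 1)
    (him : Φim none = 0) (Φ : CTree C → R) :
    ∃! Φ', Φ' none = 1 ∧ ∀ τ, Φ' τ = Φex τ + compose Φ Φim τ + starProd (Φ' - Φ) Φim τ := by
  obtain ⟨Φ', h, hu⟩ := existsUnique_weights
    (fun φ τ => Φex τ + compose Φ Φim τ + starProd (φ - Φ) Φim τ)
    fun φ φ' τ hφ => by
      rw [starProd_congr him (φ := φ - Φ) (φ' := φ' - Φ) fun σ hσ => by simp [hφ σ hσ]]
  refine ⟨Φ', ⟨by rw [h none]; simp [compose_none, starProd_none, hex, him], h⟩,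
    fun Φ'' h' => hu _ h'.2⟩

theorem existsUnique_modifiedNewtonWeights {Φex Φim : CTree C → R} (hex : Φex none = 1)
    (him : Φim none = 0) (Φ₀ : CTree C → R) :
    ∃! Φk, IsModifiedNewtonWeights Φex Φim Φ₀ Φk := by
  choose F hF hu using existsUnique_newtonStep hex him
  refine ⟨fun k => Nat.rec Φ₀ (fun _ => F) k, ⟨rfl, fun k => hF _⟩, fun Φk h => funext fun k => ?_⟩
  induction k with
  | zero => exact h.1
  | succ k ih => exact (hu _ _ (h.2 k)).trans (congrArg F ih)

/-! ### Change of the coefficient ring -/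

variable {S : Type*} [CommRing S] [Algebra ℚ S]

theorem map_compose (f : R →ₐ[ℚ] S) (φ ψ : CTree C → R) (τ : CTree C) :
    f (compose φ ψ τ) = compose (f ∘ φ) (f ∘ ψ) τ := by
  simp [compose, map_multiset_prod, Multiset.map_map]

theorem map_starProd (f : R →ₐ[ℚ] S) (φ ψ : CTree C → R) (τ : CTree C) :
    f (starProd φ ψ τ) = starProd (f ∘ φ) (f ∘ ψ) τ := by
  rw [starProd, starProd]
  split_ifs
  · simp
  · simp [map_multiset_sum, Multiset.map_map]

theorem IsMethodWeights.map (f : R →ₐ[ℚ] S) {Φex Φim Φ : CTree C → R}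
    (h : IsMethodWeights Φex Φim Φ) : IsMethodWeights (f ∘ Φex) (f ∘ Φim) (f ∘ Φ) :=
  ⟨by simp [h.1], fun τ => by
    rw [Function.comp_apply, h.2 τ, map_add, map_compose, Function.comp_apply]⟩

theorem IsModifiedNewtonWeights.map (f : R →ₐ[ℚ] S) {Φex Φim Φ₀ : CTree C → R}
    {Φk : ℕ → CTree C → R} (h : IsModifiedNewtonWeights Φex Φim Φ₀ Φk) :
    IsModifiedNewtonWeights (f ∘ Φex) (f ∘ Φim) (f ∘ Φ₀) fun k => f ∘ Φk k := by
  refine ⟨congrArg (f ∘ ·) h.1, fun k => ⟨by simp [(h.2 k).1], fun τ => ?_⟩⟩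
  change f (Φk (k + 1) τ) = _
  rw [(h.2 k).2 τ, map_add, map_add, map_compose, map_starProd, Function.comp_apply]
  congr 2
  ext
  simp

end Weights

/-- Evaluation of the weights at a fixed step size and outcome. -/
noncomputable def evalXi {Ω : Type*} [MeasurableSpace Ω] (h : ℝ≥0) (ω : Ω) : Xi Ω →ₐ[ℚ] ℝ :=
  (((Pi.evalAlgHom ℝ (fun _ : Ω => ℝ) ω).comp
    (Pi.evalAlgHom ℝ (fun _ : ℝ≥0 => Ω → ℝ) h)).comp (Xi Ω).val).restrictScalars ℚ

theorem path_eq_comp {Ω : Type*} [MeasurableSpace Ω] (φ : CTree C → Xi Ω) (h : ℝ≥0) (ω : Ω) :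
    path φ h ω = evalXi h ω ∘ φ := rfl

/-! ### The function `ram` -/

theorem RTree.ram_eq (τ : RTree C) : τ.ram = if τ.children.card = 0 then 1
    else if τ.children.card = 1 then (τ.children.map RTree.ram).sup
    else 1 + (τ.children.map RTree.ram).sup := by
  rw [RTree.ram, Multiset.attach_map_val' τ.children RTree.ram]

theorem RTree.ram_le_of_mem_children {τ σ : RTree C} (h : σ ∈ τ.children) : σ.ram ≤ τ.ram := by
  have h1 := Multiset.le_sup (Multiset.mem_map_of_mem RTree.ram h)
  have h2 : τ.children.card ≠ 0 := fun h0 => by simp [Multiset.card_eq_zero.1 h0] at h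
  rw [τ.ram_eq, if_neg h2]
  split_ifs <;> omega

theorem RTree.ram_lt_of_mem_children {τ σ : RTree C} (h : σ ∈ τ.children)
    (h2 : 2 ≤ τ.children.card) : σ.ram < τ.ram := by
  have h1 := Multiset.le_sup (Multiset.mem_map_of_mem RTree.ram h)
  rw [τ.ram_eq, if_neg (by omega), if_neg (by omega)]
  omega

theorem exists_mem_eq_sup {s : Multiset ℕ} (h : s ≠ 0) : s.sup ∈ s := by
  induction s using Multiset.induction_on with
  | empty => exact absurd rfl h
  | cons a s ih =>
    rw [Multiset.sup_cons]
    by_cases hs : s = 0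
    · simp [hs]
    · rcases le_total a s.sup with h1 | h1
      · rw [sup_eq_right.2 h1]; exact Multiset.mem_cons_of_mem (ih hs)
      · rw [sup_eq_left.2 h1]; exact Multiset.mem_cons_self _ _

theorem RTree.exists_ram_eq {τ : RTree C} (h : τ.children ≠ 0) :
    ∃ σ ∈ τ.children, τ.ram = σ.ram + if 2 ≤ τ.children.card then 1 else 0 := by
  obtain ⟨σ, hσ, h1⟩ := Multiset.mem_map.1
    (exists_mem_eq_sup (s := τ.children.map RTree.ram) (by simpa using h))
  refine ⟨σ, hσ, ?_⟩
  have h2 := Multiset.card_pos.2 h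
  rw [τ.ram_eq, ← h1, if_neg h2.ne']
  split_ifs <;> omega

theorem RTree.ram_of_children_eq_zero {τ : RTree C} (h : τ.children = 0) : τ.ram = 1 := by
  rw [τ.ram_eq, h]; rfl

/-- A tree left over is a subtree of `τ`; and when at least two trees are left over, a
ramification lies above each of them. -/
theorem RTree.ram_le_of_mem_ST {τ : RTree C} {p : CTree C × Multiset (RTree C)} (hp : p ∈ τ.ST)
    {δ : RTree C} (hδ : δ ∈ p.2) : δ.ram ≤ τ.ram ∧ (2 ≤ p.2.card → δ.ram < τ.ram) := by
  induction h : τ.size using Nat.strong_induction_on generalizing τ p with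
  | _ n ih =>
    subst h
    rcases p with ⟨_ | η, ω⟩
    · rw [RTree.mem_ST_none] at hp
      subst hp
      obtain rfl : δ = τ := by simpa using hδ
      simp
    · obtain ⟨u, hu, -, rfl⟩ := RTree.mem_ST_some.1 hp
      obtain ⟨h1, h2⟩ := RTree.mem_splittings.1 hu
      obtain ⟨t, ht, htδ⟩ : ∃ t ∈ u, δ ∈ t.2.2 := by
        have h3 : δ ∈ Multiset.join (u.map fun t => t.2.2) := hδ
        obtain ⟨s, hs, h4⟩ := Multiset.mem_join.1 h3
        obtain ⟨t, ht, rfl⟩ := Multiset.mem_map.1 hs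
        exact ⟨t, ht, h4⟩
      have ht' : t.1 ∈ τ.children := h1 ▸ Multiset.mem_map_of_mem _ ht
      obtain ⟨h3, h4⟩ := ih _ (RTree.size_lt ht') (h2 t ht) htδ rfl
      refine ⟨h3.trans (RTree.ram_le_of_mem_children ht'), fun hc => ?_⟩
      by_cases h5 : 2 ≤ τ.children.card
      · exact h3.trans_lt (RTree.ram_lt_of_mem_children ht' h5)
      · have h6 : u.card = 1 := by
          have := Multiset.card_pos_iff_exists_mem.2 ⟨t, ht⟩
          rw [← h1, Multiset.card_map] at h5
          omega
        obtain ⟨t', rfl⟩ := Multiset.card_eq_one.1 h6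
        obtain rfl : t = t' := by simpa using ht
        refine (h4 (by simpa [joinRemainders] using hc)).trans_le
          (RTree.ram_le_of_mem_children ht')

/-- With one tree `δ` left over, the terms `Φ_k(δ)` of `Φ_k ∘ Φim` and
`Φ_{k+1}(δ) - Φ_k(δ)` of the correction add up to `Φ_{k+1}(δ)`; with several trees left over, each
of them has a smaller value of `ram`. -/
theorem isGrowthFunction_ram {R : Type*} [CommRing R] [Algebra ℚ R]
    {Φex Φim Φ₀ Φ : CTree C → R} {Φk : ℕ → CTree C → R} (him : Φim none = 0)
    (hk : IsModifiedNewtonWeights Φex Φim Φ₀ Φk) (hΦ : IsMethodWeights Φex Φim Φ) :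
    IsGrowthFunction ram Φk Φ := by
  intro k hind
  obtain ⟨h1, h2⟩ := hk.2 k
  rintro (_ | τ) hτ
  · rw [h1, hΦ.1]
  induction h : τ.size using Nat.strong_induction_on generalizing τ with
  | _ n ih =>
    subst h
    rw [h2, hΦ.2, add_assoc]
    congr 1
    rw [starProd_some]
    change ∑ p ∈ τ.ST, τ.gamma p.1 p.2 • _ + _ = ∑ p ∈ τ.ST, τ.gamma p.1 p.2 • _
    rw [← Finset.sum_add_distrib]
    refine Finset.sum_congr rfl fun p hp => ?_
    rw [← smul_add]
    congr 1
    rcases p with ⟨_ | η, ω⟩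
    · simp [him]
    have hτ' : τ.ram ≤ k + 1 := hτ
    by_cases hω : ω.card = 1
    · obtain ⟨δ, rfl⟩ := Multiset.card_eq_one.1 hω
      have hδ : δ ∈ ({δ} : Multiset (RTree C)) := Multiset.mem_singleton_self δ
      have := ih _ (RTree.size_lt_of_mem_ST hp hδ) δ
        ((RTree.ram_le_of_mem_ST hp hδ).1.trans hτ') rfl
      simp [← this, mul_sub]
    · rw [if_neg hω, add_zero]
      congr 2
      refine Multiset.map_congr rfl fun δ hδ => hind _ ?_
      have h3 : 2 ≤ ω.card := by
        have : 0 < ω.card := Multiset.card_pos_iff_exists_mem.2 ⟨δ, hδ⟩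
        omega
      have := (RTree.ram_le_of_mem_ST hp hδ).2 h3
      exact Nat.lt_succ_iff.1 (this.trans_le hτ')

/-! ### Sharpness -/

/-- The weights of the implicit Euler method with unit step: `1` at the one-vertex trees. -/
noncomputable def eulerWeight (R : Type*) [CommRing R] (τ : CTree C) : R :=
  open Classical in if numVertices τ = 1 then 1 else 0

/-- The weights of the constant predictor `x₀`. -/
noncomputable def unitWeight (R : Type*) [CommRing R] (τ : CTree C) : R :=
  open Classical in if τ = none then 1 else 0

theorem numVertices_some_eq_one {τ : RTree C} : numVertices (some τ) = 1 ↔ τ.children = 0 := by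
  change τ.size = 1 ↔ _
  rw [τ.size_eq]
  constructor
  · intro h
    refine Multiset.eq_zero_of_forall_notMem fun σ hσ => ?_
    have h1 := Multiset.single_le_sum (fun _ _ => Nat.zero_le _) _
      (Multiset.mem_map_of_mem RTree.size hσ)
    have := σ.size_pos
    omega
  · intro h
    simp [h]

/-- With the weights of the implicit Euler method, only the splitting of `τ` into its root and
its branches contributes to a sum over `ST(τ)`; its `γ` is `1`. -/
theorem sum_ST_eulerWeight {R : Type*} [CommRing R] [Algebra ℚ R] (τ : RTree C)
    (f : Multiset (RTree C) → R) :
    ∑ p ∈ τ.ST, τ.gamma p.1 p.2 • (eulerWeight R p.1 * f p.2) = f τ.children := by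
  rw [τ.sum_ST_gamma_smul fun p => eulerWeight R p.1 * f p.2]
  have h0 : eulerWeight R (none : CTree C) = 0 := by simp [eulerWeight, numVertices]
  let i : RTree C → Triple C := fun σ => (σ, none, {σ})
  have hi : Function.Injective i := fun σ σ' h => congrArg Prod.fst h
  have hu : τ.children.map i ∈ τ.splittings := by
    rw [RTree.mem_splittings]
    refine ⟨by simp [Multiset.map_map, i], fun t ht => ?_⟩
    obtain ⟨σ, -, rfl⟩ := Multiset.mem_map.1 ht
    exact RTree.mem_ST_none.2 rfl
  rw [h0, zero_mul, zero_add, Finset.sum_eq_single (τ.children.map i)]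
  · have h1 : joinRemainders (τ.children.map i) = τ.children := by
      simp [joinRemainders, i, Multiset.map_map, Multiset.sum_map_singleton]
    have h2 : eulerWeight R (some (joinSubtrees τ.root (τ.children.map i))) = 1 := by
      refine if_pos (numVertices_some_eq_one.2 ?_)
      rw [joinSubtrees_children, Multiset.filterMap_map]
      exact Multiset.eq_zero_of_forall_notMem fun σ hσ => by simp [i] at hσ
    have h3 : ((τ.children.map i).map Triple.gamma).prod = 1 := by
      refine Multiset.prod_eq_one fun q hq => ?_
      simp only [Multiset.map_map, Multiset.mem_map] at hq
      obtain ⟨σ, -, rfl⟩ := hq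
      exact σ.gamma_none
    simp only
    rw [h1, h2, h3, multFactorial_map hi, div_self (multFactorial_ne_zero _)]
    simp
  · intro u hu' hne
    have : eulerWeight R (some (joinSubtrees τ.root u)) = 0 := by
      refine if_neg fun h => hne ?_
      rw [numVertices_some_eq_one, joinSubtrees_children] at h
      obtain ⟨h1, h2⟩ := RTree.mem_splittings.1 hu'
      rw [← h1, Multiset.map_map]
      conv_lhs => rw [← Multiset.map_id u]
      refine Multiset.map_congr rfl fun t ht => ?_
      rcases t with ⟨σ, _ | ϑ, ω⟩
      · rw [RTree.mem_ST_none.1 (h2 _ ht)]; rfl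
      · have : ϑ ∈ u.filterMap fun x => x.2.1 := (Multiset.mem_filterMap _ _).2 ⟨_, ht, rfl⟩
        simp [h] at this
    simp [this]
  · exact fun h => absurd hu h

theorem compose_eulerWeight {R : Type*} [CommRing R] [Algebra ℚ R] (φ : CTree C → R)
    (τ : RTree C) : compose φ (eulerWeight R) (some τ) =
      (τ.children.map fun δ => φ (some δ)).prod :=
  sum_ST_eulerWeight τ fun ω => (ω.map fun δ => φ (some δ)).prod

theorem starProd_eulerWeight {R : Type*} [CommRing R] [Algebra ℚ R] (φ : CTree C → R)
    (τ : RTree C) : starProd φ (eulerWeight R) (some τ) =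
      if τ.children.card = 1 then (τ.children.map fun δ => φ (some δ)).sum else 0 := by
  rw [starProd_some,
    ← sum_ST_eulerWeight τ fun ω => if ω.card = 1 then (ω.map fun δ => φ (some δ)).sum else 0]
  refine Finset.sum_congr rfl fun p _ => ?_
  split_ifs <;> simp

theorem unitWeight_some (R : Type*) [CommRing R] (τ : RTree C) :
    unitWeight R (some τ) = 0 := if_neg (Option.some_ne_none τ)

theorem methodWeights_euler {R : Type*} [CommRing R] [Algebra ℚ R] {Φ : CTree C → R}
    (h : IsMethodWeights (unitWeight R) (eulerWeight R) Φ) (τ : RTree C) : Φ (some τ) = 1 := by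
  induction hn : τ.size using Nat.strong_induction_on generalizing τ with
  | _ n ih =>
    subst hn
    rw [h.2, unitWeight_some, zero_add, compose_eulerWeight]
    refine Multiset.prod_eq_one fun x hx => ?_
    obtain ⟨σ, hσ, rfl⟩ := Multiset.mem_map.1 hx
    exact ih _ (RTree.size_lt hσ) σ rfl

theorem newtonWeights_euler {R : Type*} [CommRing R] [Algebra ℚ R] {Φk : ℕ → CTree C → R}
    (h : IsModifiedNewtonWeights (unitWeight R) (eulerWeight R) (unitWeight R) Φk) (τ : RTree C)
    {k : ℕ} (hk : k < τ.ram) : Φk k (some τ) = 0 := by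
  induction k generalizing τ with
  | zero => rw [h.1, unitWeight_some]
  | succ k ihk =>
    induction hn : τ.size using Nat.strong_induction_on generalizing τ with
    | _ n ih =>
      subst hn
      have h0 : τ.children ≠ 0 := fun h0 => by
        rw [RTree.ram_of_children_eq_zero h0] at hk; omega
      obtain ⟨σ, hσ, h1⟩ := RTree.exists_ram_eq h0
      rw [(h.2 k).2, unitWeight_some, zero_add, compose_eulerWeight, starProd_eulerWeight]
      by_cases h2 : τ.children.card = 1
      · obtain ⟨σ', h3⟩ := Multiset.card_eq_one.1 h2
        obtain rfl : σ = σ' := by simpa [h3] using hσ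
        have := ih _ (RTree.size_lt hσ) σ (by rw [h2] at h1; simp at h1; omega) rfl
        simp [h3, this]
      · have h3 := Multiset.card_pos.2 h0
        rw [if_neg h2, add_zero]
        refine Multiset.prod_eq_zero (Multiset.mem_map.2 ⟨σ, hσ, ihk σ ?_⟩)
        rw [if_pos (by omega)] at h1
        omega

/-! ### Ramifications along branches -/

theorem ramifications_cons (τ : RTree C) (b : List (RTree C)) :
    ramifications (τ :: b) = ramifications b + if 2 ≤ τ.children.card then 1 else 0 := by
  simp [ramifications, List.countP_cons]

theorem isGreatest_ramifications (τ : RTree C) :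
    IsGreatest {n | ∃ b, IsBranch τ b ∧ n = 1 + ramifications b} τ.ram := by
  constructor
  · induction hn : τ.size using Nat.strong_induction_on generalizing τ with
    | _ n ih =>
      subst hn
      by_cases h0 : τ.children = 0
      · refine ⟨[τ], .leaf τ h0, ?_⟩
        rw [RTree.ram_of_children_eq_zero h0, ramifications_cons]
        simp [h0, ramifications]
      · obtain ⟨σ, hσ, h1⟩ := RTree.exists_ram_eq h0
        obtain ⟨b, hb, h2⟩ := ih _ (RTree.size_lt hσ) σ rfl
        refine ⟨τ :: b, .cons τ σ b hσ hb, ?_⟩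
        rw [h1, h2, ramifications_cons]
        omega
  · rintro _ ⟨b, hb, rfl⟩
    induction hb with
    | leaf τ h => rw [RTree.ram_of_children_eq_zero h, ramifications_cons]; simp [h, ramifications]
    | cons τ σ b h hb ih =>
      rw [ramifications_cons]
      have h1 := RTree.ram_le_of_mem_children h
      split_ifs with h2
      · have := RTree.ram_lt_of_mem_children h h2
        omega
      · omega

/-! ### Higher derivatives as functions of multisets of directions -/

section Calculus

variable {E F : Type*} [NormedAddCommGroup E] [NormedSpace ℝ E] [NormedAddCommGroup F]
  [NormedSpace ℝ F]

/-- The iterated directional derivative of `f` in the directions of a list. -/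
noncomputable def dirDeriv (f : E → F) : List E → E → F
  | [] => f
  | v :: l => fun x => fderiv ℝ (dirDeriv f l) x v

theorem contDiff_dirDeriv {f : E → F} (hf : ContDiff ℝ (⊤ : ℕ∞) f) (l : List E) :
    ContDiff ℝ (⊤ : ℕ∞) (dirDeriv f l) := by
  induction l with
  | nil => exact hf
  | cons v l ih => exact (ih.fderiv_right (m := (⊤ : ℕ∞)) le_rfl).clm_apply contDiff_const

theorem dirDeriv_append (f : E → F) (l l' : List E) :
    dirDeriv f (l ++ l') = dirDeriv (dirDeriv f l') l := by
  induction l with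
  | nil => rfl
  | cons v l ih => rw [List.cons_append, dirDeriv, ih, dirDeriv]

theorem dirDeriv_perm {f : E → F} (hf : ContDiff ℝ (⊤ : ℕ∞) f) {l l' : List E} (h : l.Perm l') :
    dirDeriv f l = dirDeriv f l' := by
  induction h with
  | nil => rfl
  | cons v _ ih => rw [dirDeriv, dirDeriv, ih]
  | trans _ _ ih ih' => exact ih.trans ih'
  | swap v w l =>
    ext x
    have h1 := contDiff_dirDeriv hf l
    have h2 : Differentiable ℝ (fderiv ℝ (dirDeriv f l)) :=
      (h1.fderiv_right (m := (⊤ : ℕ∞)) le_rfl).differentiable (by simp)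
    have h3 : IsSymmSndFDerivAt ℝ (dirDeriv f l) x :=
      h1.contDiffAt.isSymmSndFDerivAt (by
        rw [minSmoothness_of_isRCLikeNormedField]
        exact WithTop.coe_le_coe.2 (le_top (a := (2 : ℕ∞))))
    have h4 : ∀ u u' : E, fderiv ℝ (fun y => fderiv ℝ (dirDeriv f l) y u) x u' =
        fderiv ℝ (fderiv ℝ (dirDeriv f l)) x u' u := fun u u' => by
      rw [fderiv_clm_apply (h2 x) (differentiableAt_const u)]
      simp
    simp only [dirDeriv]
    rw [h4, h4]
    exact h3 _ _

theorem iteratedFDeriv_apply_eq_dirDeriv {f : E → F} (hf : ContDiff ℝ (⊤ : ℕ∞) f) {n : ℕ} (x : E)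
    (v : Fin n → E) : iteratedFDeriv ℝ n f x v = dirDeriv f (List.ofFn v) x := by
  induction n generalizing x with
  | zero => simp [dirDeriv]
  | succ n ih =>
    rw [iteratedFDeriv_succ_apply_left, List.ofFn_succ, dirDeriv]
    have h1 : (fun y => iteratedFDeriv ℝ n f y (Fin.tail v)) =
        dirDeriv f (List.ofFn fun i : Fin n => v i.succ) := funext fun y => ih y _
    rw [← h1]
    refine (fderiv_continuousMultilinear_apply_const_apply ?_ _ _).symm
    exact (hf.differentiable_iteratedFDeriv (by exact_mod_cast ENat.natCast_lt_top n)) x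

/-- The iterated derivative `f^{(n)}(x)(v₁, …, vₙ)` as a function of the multiset of directions. -/
noncomputable def multiDeriv (f : E → F) (x : E) (s : Multiset E) : F := dirDeriv f s.toList x

theorem multiDeriv_coe {f : E → F} (hf : ContDiff ℝ (⊤ : ℕ∞) f) (x : E) (l : List E) :
    multiDeriv f x l = dirDeriv f l x := by
  rw [multiDeriv, dirDeriv_perm hf (Multiset.coe_eq_coe.1 (Multiset.coe_toList (l : Multiset E)))]

theorem multiDeriv_cons {f : E → F} (hf : ContDiff ℝ (⊤ : ℕ∞) f) (x v : E) (s : Multiset E) :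
    multiDeriv f x (v ::ₘ s) = fderiv ℝ (fun y => multiDeriv f y s) x v := by
  induction s using Quotient.inductionOn with
  | h l =>
    change multiDeriv f x ((v :: l : List E) : Multiset E) = _
    have h1 : (fun y => multiDeriv f y ⟦l⟧) = dirDeriv f l := funext fun y => multiDeriv_coe hf y l
    rw [multiDeriv_coe hf, h1, dirDeriv]

theorem iteratedFDeriv_apply_eq_multiDeriv {f : E → F} (hf : ContDiff ℝ (⊤ : ℕ∞) f) {n : ℕ}
    (x : E) (v : Fin n → E) :
    iteratedFDeriv ℝ n f x v = multiDeriv f x (List.ofFn v) := by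
  rw [iteratedFDeriv_apply_eq_dirDeriv hf, multiDeriv_coe hf]

theorem multiDeriv_smul_cons {f : E → F} (hf : ContDiff ℝ (⊤ : ℕ∞) f) (x : E) (c : ℝ) (v : E)
    (s : Multiset E) : multiDeriv f x ((c • v) ::ₘ s) = c • multiDeriv f x (v ::ₘ s) := by
  rw [multiDeriv_cons hf, multiDeriv_cons hf, map_smul]

theorem multiDeriv_sum_cons {f : E → F} (hf : ContDiff ℝ (⊤ : ℕ∞) f) (x : E) {ι : Type*}
    (T : Finset ι) (v : ι → E) (s : Multiset E) :
    multiDeriv f x ((∑ i ∈ T, v i) ::ₘ s) = ∑ i ∈ T, multiDeriv f x (v i ::ₘ s) := by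
  simp_rw [multiDeriv_cons hf, map_sum]

theorem multiDeriv_map_smul_add {f : E → F} (hf : ContDiff ℝ (⊤ : ℕ∞) f) (x : E) {ι : Type*}
    (u : Multiset ι) (c : ι → ℝ) (v : ι → E) (s : Multiset E) :
    multiDeriv f x (u.map (fun i => c i • v i) + s) =
      (u.map c).prod • multiDeriv f x (u.map v + s) := by
  induction u using Multiset.induction_on generalizing s with
  | empty => simp
  | cons i u ih =>
    rw [Multiset.map_cons, Multiset.cons_add, multiDeriv_smul_cons hf, ← Multiset.add_cons, ih,
      Multiset.map_cons, Multiset.map_cons, Multiset.prod_cons, Multiset.cons_add,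
      Multiset.add_cons, smul_smul]

theorem multiDeriv_map_smul {f : E → F} (hf : ContDiff ℝ (⊤ : ℕ∞) f) (x : E) {ι : Type*}
    (u : Multiset ι) (c : ι → ℝ) (v : ι → E) :
    multiDeriv f x (u.map fun i => c i • v i) = (u.map c).prod • multiDeriv f x (u.map v) := by
  simpa using multiDeriv_map_smul_add hf x u c v 0

/-! ### Expansion of symmetric multilinear expressions -/

section Expansion

variable {ι κ : Type*} [DecidableEq ι] [DecidableEq κ]

/-- The multisets of elements of `T` that are mapped by `key` to the multiset `U`. -/
noncomputable def keyedMultisets (T : Finset ι) (key : ι → κ) (U : Multiset κ) :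
    Finset (Multiset ι) :=
  (Multiset.Sections (U.map fun k => (T.filter fun t => key t = k).val)).toFinset

theorem mem_keyedMultisets {T : Finset ι} {key : ι → κ} {U : Multiset κ} {u : Multiset ι} :
    u ∈ keyedMultisets T key U ↔ u.map key = U ∧ ∀ t ∈ u, t ∈ T := by
  rw [keyedMultisets, Multiset.mem_toFinset, mem_sections_map (key := key)]
  · simp
  · intro k a ha
    rw [Finset.mem_val] at ha
    exact (Finset.mem_filter.1 ha).2

/-- Double counting of the multisets over `k ::ₘ U` with a marked element of key `k`: each of them
has as many elements of key `k`, counted with multiplicity, as `k ::ₘ U` has occurrences of `k`. -/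
theorem sum_keyedMultisets_cons {M : Type*} [AddCommGroup M] [Module ℝ M] (T : Finset ι)
    (key : ι → κ) (k : κ) (U : Multiset κ) (G : Multiset ι → M) :
    ((U.count k : ℝ) + 1) • ∑ u ∈ keyedMultisets T key (k ::ₘ U), (multFactorial u : ℝ)⁻¹ • G u =
      ∑ t ∈ T with key t = k,
        ∑ u ∈ keyedMultisets T key U, (multFactorial u : ℝ)⁻¹ • G (t ::ₘ u) := by
  have h1 : ∀ u ∈ keyedMultisets T key (k ::ₘ U),
      ((U.count k : ℝ) + 1) • (multFactorial u : ℝ)⁻¹ • G u =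
        ∑ t ∈ T with key t = k, (u.count t : ℝ) • (multFactorial u : ℝ)⁻¹ • G u := by
    intro u hu
    obtain ⟨h2, h3⟩ := mem_keyedMultisets.1 hu
    rw [← Finset.sum_smul]
    congr 1
    have h4 : (k ::ₘ U).count k = ∑ t ∈ T with key t = k, u.count t := by
      rw [← h2, Multiset.count_map, ← Multiset.sum_count_eq_card (s := T.filter fun t => key t = k)]
      · refine Finset.sum_congr rfl fun t ht => ?_
        rw [Multiset.count_filter, if_pos (Finset.mem_filter.1 ht).2.symm]
      · intro t ht
        rw [Multiset.mem_filter] at ht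
        exact Finset.mem_filter.2 ⟨h3 t ht.1, ht.2.symm⟩
    rw [Multiset.count_cons_self] at h4
    exact_mod_cast h4
  rw [Finset.smul_sum, Finset.sum_congr rfl h1, Finset.sum_comm]
  refine Finset.sum_congr rfl fun t ht => ?_
  obtain ⟨htT, rfl⟩ := Finset.mem_filter.1 ht
  have h5 : (keyedMultisets T key U).image (t ::ₘ ·) ⊆ keyedMultisets T key (key t ::ₘ U) := by
    intro u hu
    obtain ⟨v, hv, rfl⟩ := Finset.mem_image.1 hu
    obtain ⟨h2, h3⟩ := mem_keyedMultisets.1 hv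
    refine mem_keyedMultisets.2 ⟨by rw [Multiset.map_cons, h2], fun s hs => ?_⟩
    rcases Multiset.mem_cons.1 hs with rfl | hs
    exacts [htT, h3 s hs]
  rw [← Finset.sum_subset h5, Finset.sum_image fun u _ v _ h => (Multiset.cons_inj_right t).1 h]
  · refine Finset.sum_congr rfl fun u _ => ?_
    rw [multFactorial_cons, Multiset.count_cons_self, smul_smul, Rat.cast_mul, mul_inv, ← mul_assoc]
    push_cast
    rw [mul_inv_cancel₀ (by positivity), one_mul]
  · intro u hu hu'
    have : t ∉ u := fun htu => hu' <| by
      obtain ⟨v, rfl⟩ := Multiset.exists_cons_of_mem htu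
      obtain ⟨h2, h3⟩ := mem_keyedMultisets.1 hu
      refine Finset.mem_image_of_mem _ (mem_keyedMultisets.2 ⟨?_, fun s hs =>
        h3 s (Multiset.mem_cons_of_mem hs)⟩)
      rwa [Multiset.map_cons, Multiset.cons_inj_right] at h2
    rw [Multiset.count_eq_zero_of_notMem this, Nat.cast_zero, zero_smul]

/-- Multinomial theorem for a higher derivative `f^{(n)}(x)` in directions that are finite sums:
if `W k` is the sum of the `a t` with key `k`, the value at the multiset of the `W k`, `k ∈ U`, is
expanded into the multisets of indices over `U`. -/
theorem multiDeriv_expand {f : E → F} (hf : ContDiff ℝ (⊤ : ℕ∞) f) (x : E) (T : Finset ι)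
    (key : ι → κ) (a : ι → E) (U : Multiset κ) (B : Multiset E) :
    (multFactorial U : ℝ)⁻¹ • multiDeriv f x ((U.map fun k => ∑ t ∈ T with key t = k, a t) + B) =
      ∑ u ∈ keyedMultisets T key U, (multFactorial u : ℝ)⁻¹ • multiDeriv f x (u.map a + B) := by
  induction U using Multiset.induction_on generalizing B with
  | empty =>
    have : keyedMultisets T key 0 = {0} := by
      ext u
      rw [mem_keyedMultisets, Multiset.map_eq_zero, Finset.mem_singleton, and_iff_left_iff_imp]
      rintro rfl
      simp
    simp [this, multFactorial_zero]
  | cons k U ih =>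
    have h0 : ((U.count k : ℝ) + 1) ≠ 0 := by positivity
    rw [← (IsUnit.mk0 _ h0).smul_left_cancel, sum_keyedMultisets_cons, multFactorial_cons,
      smul_smul, Rat.cast_mul, Rat.cast_add, Rat.cast_natCast, Rat.cast_one, mul_inv,
      ← mul_assoc, mul_inv_cancel₀ h0, one_mul, Multiset.map_cons, Multiset.cons_add,
      multiDeriv_sum_cons hf, Finset.smul_sum]
    refine Finset.sum_congr rfl fun t _ => ?_
    rw [← Multiset.add_cons, ih]
    simp_rw [Multiset.map_cons, Multiset.cons_add, Multiset.add_cons]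

end Expansion

/-! ### Taylor's formula -/

/-- Taylor's formula for smooth functions on a normed space. -/
theorem taylor_isBigO [CompleteSpace F] {f : E → F} (hf : ContDiff ℝ (⊤ : ℕ∞) f) (x : E) (N : ℕ) :
    (fun v => f (x + v) - ∑ k ∈ Finset.range (N + 1),
      ((k.factorial : ℝ))⁻¹ • iteratedFDeriv ℝ k f x fun _ => v) =O[nhds 0]
      fun v => ‖v‖ ^ (N + 1) := by
  have hc : Continuous (iteratedFDeriv ℝ (N + 1) f) :=
    hf.continuous_iteratedFDeriv (by exact_mod_cast le_top)
  obtain ⟨r, hr, hC⟩ := Metric.eventually_nhds_iff.1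
    (hc.norm.continuousAt.eventually_le_const (lt_add_one ‖iteratedFDeriv ℝ (N + 1) f x‖))
  set C := ‖iteratedFDeriv ℝ (N + 1) f x‖ + 1
  refine Asymptotics.IsBigO.of_bound ((N.factorial : ℝ)⁻¹ * C) ?_
  filter_upwards [Metric.ball_mem_nhds (0 : E) hr] with v hv
  rw [mem_ball_zero_iff] at hv
  rw [map_add_eq_sum_add_integral_iteratedFDeriv (n := N) fun t _ =>
    (hf.of_le (by exact_mod_cast le_top)).contDiffAt, add_sub_cancel_left, norm_smul, norm_pow,
    norm_norm, mul_assoc, Real.norm_of_nonneg (by positivity)]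
  refine mul_le_mul_of_nonneg_left ?_ (by positivity)
  have := intervalIntegral.norm_integral_le_of_norm_le_const (a := (0 : ℝ)) (b := 1)
    (C := C * ‖v‖ ^ (N + 1))
    (f := fun t => (1 - t) ^ N • iteratedFDeriv ℝ (N + 1) f (x + t • v) fun _ => v) ?_
  · simpa using this
  · intro t ht
    rw [Set.uIoc_of_le zero_le_one] at ht
    have h1 : ‖iteratedFDeriv ℝ (N + 1) f (x + t • v)‖ ≤ C := by
      refine hC ?_
      rw [dist_self_add_left, norm_smul, Real.norm_of_nonneg ht.1.le]
      exact (mul_le_of_le_one_left (norm_nonneg _) ht.2).trans_lt hv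
    have h2 : ‖(1 - t) ^ N‖ ≤ 1 := by
      rw [norm_pow, Real.norm_of_nonneg (by linarith [ht.2])]
      exact pow_le_one₀ (by linarith [ht.2]) (by linarith [ht.1])
    have h3 := (iteratedFDeriv ℝ (N + 1) f (x + t • v)).le_of_opNorm_le h1 fun _ => v
    rw [Finset.prod_const, Finset.card_univ, Fintype.card_fin] at h3
    rw [norm_smul]
    calc _ ≤ 1 * (C * ‖v‖ ^ (N + 1)) := by gcongr
      _ = _ := one_mul _

/-! ### Substitution of a series into a power series -/

theorem hasSum_prod_norm_pi {W : Type*} [SeminormedAddCommGroup W] {Z : ℕ → W}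
    (hZ : Summable fun n => ‖Z n‖) (κ : ℕ) :
    HasSum (fun a : Fin κ → ℕ => ∏ i, ‖Z (a i)‖) ((∑' n, ‖Z n‖) ^ κ) := by
  induction κ with
  | zero => simp
  | succ κ ih =>
    rw [← (Fin.consEquiv fun _ : Fin (κ + 1) => ℕ).hasSum_iff]
    have h0 : 0 ≤ fun a : Fin κ → ℕ => ∏ i, ‖Z (a i)‖ :=
      fun _ => Finset.prod_nonneg fun _ _ => norm_nonneg _
    have h1 : 0 ≤ fun n => ‖Z n‖ := fun _ => norm_nonneg _
    have h2 : Summable fun x : ℕ × (Fin κ → ℕ) => ‖Z x.1‖ * ∏ i, ‖Z (x.2 i)‖ :=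
      Summable.mul_of_nonneg (f := fun n => ‖Z n‖) (g := fun a : Fin κ → ℕ => ∏ i, ‖Z (a i)‖)
        hZ ih.summable h1 h0
    have h : HasSum (fun x : ℕ × (Fin κ → ℕ) => ‖Z x.1‖ * ∏ i, ‖Z (x.2 i)‖)
      ((∑' n, ‖Z n‖) * (∑' n, ‖Z n‖) ^ κ) := HasSum.mul (f := fun n => ‖Z n‖)
        (g := fun a : Fin κ → ℕ => ∏ i, ‖Z (a i)‖) hZ.hasSum ih h2
    rw [← pow_succ'] at h
    convert h using 1
    funext p
    simp [Fin.prod_univ_succ, Fin.consEquiv]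

theorem norm_apply_comp_le {κ : ℕ} (M : E [×κ]→L[ℝ] F) (Z : ℕ → E) (a : Fin κ → ℕ) :
    ‖M (Z ∘ a)‖ ≤ ‖M‖ * ∏ i, ‖Z (a i)‖ := M.le_opNorm _

theorem hasSum_multilinear_pi [CompleteSpace E] [CompleteSpace F] {Z : ℕ → E}
    (hZ : Summable fun n => ‖Z n‖) {κ : ℕ} (M : E [×κ]→L[ℝ] F) :
    HasSum (fun a : Fin κ → ℕ => M (Z ∘ a)) (M fun _ => ∑' n, Z n) := by
  induction κ with
  | zero =>
    convert hasSum_unique (fun a : Fin 0 → ℕ => M (Z ∘ a)) using 2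
  | succ κ ih =>
    have h1 : Summable fun a : Fin (κ + 1) → ℕ => M (Z ∘ a) :=
      Summable.of_norm_bounded ((hasSum_prod_norm_pi hZ (κ + 1)).summable.mul_left ‖M‖)
        (norm_apply_comp_le M Z)
    rw [← (Fin.consEquiv fun _ : Fin (κ + 1) => ℕ).hasSum_iff]
    have h2 := ((Fin.consEquiv fun _ : Fin (κ + 1) => ℕ).summable_iff.2 h1).hasSum
    have h3 : ∀ n, HasSum (fun a : Fin κ → ℕ => M (Z ∘ Fin.cons n a))
        (M.curryLeft (Z n) fun _ => ∑' n, Z n) := fun n => by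
      refine (ih (M.curryLeft (Z n))).congr_fun fun a => ?_
      rw [ContinuousMultilinearMap.curryLeft_apply]
      congr 1
      ext i
      refine Fin.cases ?_ (fun j => ?_) i <;> simp
    have h4 := h2.prod_fiberwise h3
    have h5 : HasSum (fun n => M.curryLeft (Z n) fun _ => ∑' n, Z n)
        (M.curryLeft (∑' n, Z n) fun _ => ∑' n, Z n) :=
      hZ.of_norm.hasSum.mapL ((ContinuousMultilinearMap.apply ℝ (fun _ : Fin κ => E) F
        fun _ => ∑' n, Z n).comp M.curryLeft)
    have h6 : (M.curryLeft (∑' n, Z n) fun _ => ∑' n, Z n) = M fun _ => ∑' n, Z n := by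
      rw [ContinuousMultilinearMap.curryLeft_apply]
      congr 1
      ext i
      refine Fin.cases ?_ (fun j => ?_) i <;> simp
    rw [← h6, ← h4.unique h5]
    exact h2

/-- The coefficient at `n` of the formal series obtained by substituting the formal series
`∑ Z n`, `n ≥ 1`, into the power series `p`. -/
noncomputable def substCoeff (p : FormalMultilinearSeries ℝ E F) (Z : ℕ → E) (n : ℕ) : F :=
  ∑ c : Composition n, p c.length (Z ∘ c.blocksFun)

/-- The sequence of the blocks of a composition. -/
def blocksSigma (x : Σ n, Composition n) : Σ κ, Fin κ → ℕ := ⟨x.2.length, x.2.blocksFun⟩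

theorem blocksSigma_injective : Function.Injective blocksSigma := by
  intro x y h
  rw [Composition.sigma_eq_iff_blocks_eq, ← Composition.ofFn_blocksFun,
    ← Composition.ofFn_blocksFun]
  exact congrArg (fun z : Σ κ, Fin κ → ℕ => List.ofFn z.2) h

theorem exists_eq_zero_of_notMem_range {x : Σ κ, Fin κ → ℕ} (hx : x ∉ Set.range blocksSigma) :
    ∃ i, x.2 i = 0 := by
  by_contra! h
  obtain ⟨κ, a⟩ := x
  let c : Composition (List.ofFn a).sum := ⟨List.ofFn a, fun {i} hi => by
    obtain ⟨j, rfl⟩ := (List.mem_ofFn' _ _).1 hi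
    exact Nat.pos_of_ne_zero (h j), rfl⟩
  refine hx ⟨⟨_, c⟩, ?_⟩
  have h1 : List.ofFn c.blocksFun = List.ofFn a := c.ofFn_blocksFun
  rw [List.ofFn_inj'] at h1
  exact h1

/-- Rearrangement of `∑ p κ (z, …, z)` for `z = ∑ Z n` into the coefficients of the formal
substitution. -/
theorem hasSum_substCoeff [CompleteSpace E] [CompleteSpace F] (p : FormalMultilinearSeries ℝ E F)
    {Z : ℕ → E} (hZ0 : Z 0 = 0) (hZ : Summable fun n => ‖Z n‖)
    (hp : Summable fun κ => ‖p κ‖ * (∑' n, ‖Z n‖) ^ κ) :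
    HasSum (substCoeff p Z) (∑' κ, p κ fun _ => ∑' n, Z n) ∧
      (Summable fun n => ‖substCoeff p Z n‖) ∧
      ∑' n, ‖substCoeff p Z n‖ ≤ ∑' κ, ‖p κ‖ * (∑' n, ‖Z n‖) ^ κ := by
  let B : (Σ κ, Fin κ → ℕ) → ℝ := fun x => ‖p x.1‖ * ∏ i, ‖Z (x.2 i)‖
  let G : (Σ κ, Fin κ → ℕ) → F := fun x => p x.1 (Z ∘ x.2)
  have hB0 : ∀ x, 0 ≤ B x := fun x => by positivity
  have hGB : ∀ x, ‖G x‖ ≤ B x := fun x => norm_apply_comp_le _ _ _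
  have hB1 : ∀ κ, HasSum (fun a : Fin κ → ℕ => B ⟨κ, a⟩) (‖p κ‖ * (∑' n, ‖Z n‖) ^ κ) :=
    fun κ => (hasSum_prod_norm_pi hZ κ).mul_left _
  have hBs : Summable B := by
    refine (summable_sigma_of_nonneg hB0).2 ⟨fun κ => (hB1 κ).summable, ?_⟩
    simpa only [(hB1 _).tsum_eq] using hp
  have hBt : ∑' x, B x = ∑' κ, ‖p κ‖ * (∑' n, ‖Z n‖) ^ κ := by
    rw [hBs.tsum_sigma' fun κ => (hB1 κ).summable]
    simp only [(hB1 _).tsum_eq]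
  have hG : HasSum G (∑' κ, p κ fun _ => ∑' n, Z n) := by
    have h1 : Summable G := Summable.of_norm_bounded hBs hGB
    have h2 := h1.hasSum.sigma fun κ => hasSum_multilinear_pi hZ (p κ)
    rw [h2.tsum_eq]
    exact h1.hasSum
  have hB' : HasSum (B ∘ blocksSigma) (∑' x, B x) := by
    -- tuples with an entry `0` do not come from compositions, but contribute nothing as `Z 0 = 0`
    refine (blocksSigma_injective.hasSum_iff fun x hx => ?_).2 hBs.hasSum
    obtain ⟨i, hi⟩ := exists_eq_zero_of_notMem_range hx
    have : ∏ i, ‖Z (x.2 i)‖ = 0 :=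
      Finset.prod_eq_zero (Finset.mem_univ i) (by rw [hi, hZ0, norm_zero])
    simp [B, this]
  have hG' : HasSum (G ∘ blocksSigma) (∑' κ, p κ fun _ => ∑' n, Z n) := by
    refine (blocksSigma_injective.hasSum_iff fun x hx => ?_).2 hG
    obtain ⟨i, hi⟩ := exists_eq_zero_of_notMem_range hx
    exact (p x.1).map_coord_zero i (by rw [Function.comp_apply, hi, hZ0])
  have h3 : HasSum (fun n => ∑ c : Composition n, B (blocksSigma ⟨n, c⟩)) (∑' x, B x) :=
    hB'.sigma fun n => hasSum_fintype _
  have h4 : ∀ n, ‖substCoeff p Z n‖ ≤ ∑ c : Composition n, B (blocksSigma ⟨n, c⟩) := fun n =>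
    norm_sum_le_of_le _ fun c _ => hGB (blocksSigma ⟨n, c⟩)
  have h5 : Summable fun n => ‖substCoeff p Z n‖ :=
    Summable.of_nonneg_of_le (fun _ => norm_nonneg _) h4 h3.summable
  refine ⟨hG'.sigma fun n => hasSum_fintype _, h5, ?_⟩
  rw [← hBt, ← h3.tsum_eq]
  exact h5.tsum_le_tsum h4 h3.summable

/-- The Taylor series of `f` at `x`. -/
noncomputable def taylorSeries (f : E → F) (x : E) : FormalMultilinearSeries ℝ E F :=
  fun κ => ((κ.factorial : ℝ))⁻¹ • iteratedFDeriv ℝ κ f x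

variable {V : Type} [NormedAddCommGroup V] [NormedSpace ℝ V]

theorem formalEval_eq_substCoeff (f : V → V) (Y Z : ℕ → V) (h : ∀ n, n ≠ 0 → Z n = Y n) :
    formalEval f Y = substCoeff (taylorSeries f (Y 0)) Z := by
  funext n
  refine Finset.sum_congr rfl fun c _ => ?_
  have : Z ∘ c.blocksFun = fun i => Y (c.blocksFun i) :=
    funext fun i => h _ (Nat.one_le_iff_ne_zero.1 (c.one_le_blocksFun i))
  rw [this]
  rfl

theorem substCoeff_pow_smul (p : FormalMultilinearSeries ℝ E F) (Z : ℕ → E) (s : ℝ) (n : ℕ) :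
    substCoeff p (fun k => s ^ k • Z k) n = s ^ n • substCoeff p Z n := by
  rw [substCoeff, substCoeff, Finset.smul_sum]
  refine Finset.sum_congr rfl fun c _ => ?_
  have h1 : ((fun k => s ^ k • Z k) ∘ c.blocksFun) =
      fun i => s ^ c.blocksFun i • (Z ∘ c.blocksFun) i := rfl
  rw [h1, ContinuousMultilinearMap.map_smul_univ, Finset.prod_pow_eq_pow_sum, c.sum_blocksFun]

theorem isBigO_pow_pow_zero {m n : ℕ} (h : m ≤ n) :
    (fun s : ℝ => s ^ n) =O[nhds 0] fun s => s ^ m := by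
  refine Asymptotics.IsBigO.of_bound 1 ?_
  filter_upwards [Metric.closedBall_mem_nhds (0 : ℝ) one_pos] with s hs
  rw [norm_pow, norm_pow, one_mul]
  exact pow_le_pow_of_le_one (norm_nonneg _) (by simpa using hs) h

/-- The formal value `formalEval f Y` is the Taylor expansion of `f` along the curve
`s ↦ ∑ sⁿ Y n`. -/
theorem formalEval_isBigO [CompleteSpace V] {f : V → V} (hf : ContDiff ℝ (⊤ : ℕ∞) f) (Y : ℕ → V)
    (N : ℕ) :
    (fun s : ℝ => f (Y 0 + ∑ n ∈ Finset.Icc 1 N, s ^ n • Y n) -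
      ∑ n ∈ Finset.range (N + 1), s ^ n • formalEval f Y n) =O[nhds 0] fun s => s ^ (N + 1) := by
  -- Cutting off both series at order `N` turns all sums into finite ones, and changes the
  -- coefficients only beyond order `N`.
  let Z : ℕ → V := fun n => if n ∈ Finset.Icc 1 N then Y n else 0
  let p : FormalMultilinearSeries ℝ V V := fun κ =>
    if κ ∈ Finset.range (N + 1) then taylorSeries f (Y 0) κ else 0
  let v : ℝ → V := fun s => ∑ n ∈ Finset.Icc 1 N, s ^ n • Y n
  have hZs : ∀ s : ℝ, HasSum (fun n => s ^ n • Z n) (v s) := fun s => by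
    have h : v s = ∑ n ∈ Finset.Icc 1 N, s ^ n • Z n :=
      Finset.sum_congr rfl fun n hn => by simp only [Z, if_pos hn]
    rw [h]
    exact hasSum_sum_of_ne_finset_zero fun n hn => by simp only [Z, if_neg hn, smul_zero]
  have hZn : ∀ s : ℝ, Summable fun n => ‖s ^ n • Z n‖ := fun s =>
    summable_of_ne_finset_zero (s := Finset.Icc 1 N) fun n hn => by
      simp only [Z, if_neg hn, smul_zero, norm_zero]
  have hp : ∀ ρ : ℝ, Summable fun κ => ‖p κ‖ * ρ ^ κ := fun ρ =>
    summable_of_ne_finset_zero (s := Finset.range (N + 1)) fun κ hκ => by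
      simp only [p, if_neg hκ, norm_zero, zero_mul]
  have hP : ∀ w : V, ∑' κ, p κ (fun _ => w) = ∑ κ ∈ Finset.range (N + 1),
      ((κ.factorial : ℝ))⁻¹ • iteratedFDeriv ℝ κ f (Y 0) fun _ => w := fun w => by
    rw [tsum_eq_sum (s := Finset.range (N + 1)) fun κ hκ => by simp only [p, if_neg hκ]; rfl]
    exact Finset.sum_congr rfl fun κ hκ => by simp only [p, if_pos hκ]; rfl
  have hsum : ∀ s : ℝ, HasSum (fun n => s ^ n • substCoeff p Z n) (∑' κ, p κ fun _ => v s) := by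
    intro s
    have h := (hasSum_substCoeff p (Z := fun n => s ^ n • Z n) (by simp [Z]) (hZn s) (hp _)).1
    rw [(hZs s).tsum_eq] at h
    exact h.congr_fun fun n => (substCoeff_pow_smul p Z s n).symm
  have hcoef : ∀ n ∈ Finset.range (N + 1), substCoeff p Z n = formalEval f Y n := by
    intro n hn
    refine Finset.sum_congr rfl fun c _ => ?_
    have hn' := Nat.lt_succ_iff.1 (Finset.mem_range.1 hn)
    have h1 : c.length ∈ Finset.range (N + 1) :=
      Finset.mem_range.2 (Nat.lt_succ_iff.2 (c.length_le.trans hn'))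
    have h2 : Z ∘ c.blocksFun = fun i => Y (c.blocksFun i) := funext fun i =>
      if_pos (Finset.mem_Icc.2 ⟨c.one_le_blocksFun i, (c.blocksFun_le i).trans hn'⟩)
    simp only [p, if_pos h1, h2]
    rfl
  have habs : Summable fun n => ‖substCoeff p Z n‖ :=
    (hasSum_substCoeff p (by simp [Z]) (by simpa using hZn 1) (hp _)).2.1
  have hpow : ∀ n, 1 ≤ n → (fun s : ℝ => s ^ n) =O[nhds 0] fun s => s := fun n hn => by
    simpa using isBigO_pow_pow_zero hn
  have hv : v =O[nhds 0] fun s : ℝ => s := by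
    refine Asymptotics.IsBigO.fun_sum (A := fun n (s : ℝ) => s ^ n • Y n) fun n hn => ?_
    have h1 := ((hpow n (Finset.mem_Icc.1 hn).1).norm_left).const_mul_left ‖Y n‖
    refine Asymptotics.IsBigO.of_norm_left (h1.congr_left fun s => ?_)
    rw [norm_smul, mul_comm]
  have hv0 : Filter.Tendsto v (nhds 0) (nhds 0) := hv.trans_tendsto Filter.tendsto_id
  have h1 : (fun s => f (Y 0 + v s) - ∑' κ, p κ fun _ => v s) =O[nhds 0]
      fun s : ℝ => s ^ (N + 1) := by
    simp_rw [hP]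
    exact ((taylor_isBigO hf (Y 0) N).comp_tendsto hv0).trans (hv.norm_left.pow (N + 1))
  have h2 : (fun s => ∑' κ, p κ (fun _ => v s) -
      ∑ n ∈ Finset.range (N + 1), s ^ n • formalEval f Y n) =O[nhds 0]
      fun s : ℝ => s ^ (N + 1) := by
    refine Asymptotics.IsBigO.of_bound (∑' n, ‖substCoeff p Z n‖) ?_
    filter_upwards [Metric.closedBall_mem_nhds (0 : ℝ) one_pos] with s hs
    have hs1 : ‖s‖ ≤ 1 := by simpa using hs
    have h3 := (hsum s).summable.sum_add_tsum_nat_add (N + 1)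
    rw [(hsum s).tsum_eq, Finset.sum_congr rfl fun n hn => by rw [hcoef n hn]] at h3
    rw [← h3, add_sub_cancel_left]
    have h4 : Summable fun n => ‖substCoeff p Z (n + (N + 1))‖ := habs.comp_injective
      (add_left_injective (N + 1))
    have h5 : ∀ n, ‖s ^ (n + (N + 1)) • substCoeff p Z (n + (N + 1))‖ ≤
        ‖substCoeff p Z (n + (N + 1))‖ * ‖s ^ (N + 1)‖ := fun n => by
      rw [norm_smul, mul_comm, pow_add, norm_mul, norm_pow s n]
      exact mul_le_mul_of_nonneg_left (mul_le_of_le_one_left (norm_nonneg _)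
        (pow_le_one₀ (norm_nonneg _) hs1)) (norm_nonneg _)
    refine (tsum_of_norm_bounded (h4.mul_right _).hasSum h5).trans ?_
    rw [tsum_mul_right]
    refine mul_le_mul_of_nonneg_right ?_ (norm_nonneg _)
    exact tsum_comp_le_tsum_of_inj habs (fun _ => norm_nonneg _) (add_left_injective (N + 1))
  exact (h1.add h2).congr_left fun s => sub_add_sub_cancel _ _ _

/-! ### Asymptotics of multilinear expressions -/

theorem iteratedFDeriv_iteratedFDeriv_apply {f : E → F} (hf : ContDiff ℝ (⊤ : ℕ∞) f) {p : ℕ}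
    (j : ℕ) (x v : E) (w : Fin p → E) :
    iteratedFDeriv ℝ j (iteratedFDeriv ℝ p f) x (fun _ => v) w =
      multiDeriv f x ((List.ofFn w : Multiset E) + Multiset.replicate j v) := by
  let L := ContinuousMultilinearMap.apply ℝ (fun _ : Fin p => E) F w
  have h1 : ContDiff ℝ (⊤ : ℕ∞) (iteratedFDeriv ℝ p f) :=
    hf.iteratedFDeriv_right (by exact_mod_cast le_rfl)
  have h2 : L ∘ iteratedFDeriv ℝ p f = dirDeriv f (List.ofFn w) :=
    funext fun y => iteratedFDeriv_apply_eq_dirDeriv hf y w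
  have h3 := L.iteratedFDeriv_comp_left (i := j) (x := x) h1.contDiffAt (by exact_mod_cast le_top)
  rw [h2] at h3
  have h4 : iteratedFDeriv ℝ j (dirDeriv f (List.ofFn w)) x (fun _ => v) =
      iteratedFDeriv ℝ j (iteratedFDeriv ℝ p f) x (fun _ => v) w :=
    congrArg (fun M : E [×j]→L[ℝ] F => M fun _ => v) h3
  rw [iteratedFDeriv_apply_eq_dirDeriv (contDiff_dirDeriv hf _), ← dirDeriv_append,
    ← multiDeriv_coe hf, List.ofFn_const, ← Multiset.coe_add, Multiset.coe_replicate,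
    add_comm] at h4
  exact h4.symm

variable {p : ℕ} {h : ℝ → ℝ} {l : Filter ℝ}

theorem isBigO_apply {M : ℝ → E [×p]→L[ℝ] F} {w : Fin p → ℝ → E} (hM : M =O[l] h)
    (hw : ∀ i, (w i) =O[l] fun _ => (1 : ℝ)) : (fun s => M s fun i => w i s) =O[l] h := by
  have h1 : (fun s => ‖M s‖ * ∏ i, ‖w i s‖) =O[l] fun s => ‖h s‖ * ∏ _i : Fin p, (1 : ℝ) :=
    hM.norm_norm.mul (Asymptotics.IsBigO.finsetProd fun i _ => (hw i).norm_left)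
  simp only [Finset.prod_const_one, mul_one] at h1
  refine (Asymptotics.IsBigO.of_bound 1 (Filter.Eventually.of_forall fun s => ?_)).trans
    h1.of_norm_right
  rw [one_mul]
  exact ((M s).le_opNorm _).trans (le_abs_self _)

theorem isBigO_apply_sub {M : ℝ → E [×p]→L[ℝ] F} {u w : Fin p → ℝ → E}
    (hM : M =O[l] fun _ => (1 : ℝ)) (hu : ∀ i, (u i) =O[l] fun _ => (1 : ℝ))
    (hw : ∀ i, (w i) =O[l] fun _ => (1 : ℝ)) (huw : ∀ i, (fun s => u i s - w i s) =O[l] h) :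
    (fun s => M s (fun i => u i s) - M s fun i => w i s) =O[l] h := by
  have hu' : (fun s i => u i s) =O[l] fun _ => (1 : ℝ) := Asymptotics.isBigO_pi.2 hu
  have hw' : (fun s i => w i s) =O[l] fun _ => (1 : ℝ) := Asymptotics.isBigO_pi.2 hw
  have huw' : (fun s => (fun i => u i s) - fun i => w i s) =O[l] h := Asymptotics.isBigO_pi.2 huw
  have h1 : (fun s => ‖M s‖ * p * (‖fun i => u i s‖ + ‖fun i => w i s‖) ^ (p - 1) *
      ‖(fun i => u i s) - fun i => w i s‖) =O[l] h := by
    have := ((hM.norm_left.mul (Asymptotics.isBigO_const_const (p : ℝ) one_ne_zero l)).mul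
      ((hu'.norm_left.add hw'.norm_left).pow (p - 1))).mul huw'.norm_left
    simpa using this
  refine (Asymptotics.IsBigO.of_bound 1 (Filter.Eventually.of_forall fun s => ?_)).trans h1
  rw [one_mul]
  refine ((M s).norm_image_sub_le _ _).trans (le_trans ?_ (le_abs_self _))
  rw [Fintype.card_fin]
  gcongr
  exact max_le_add_of_nonneg (norm_nonneg _) (norm_nonneg _)

/-- The coefficients of a polynomial curve are determined by its asymptotics at `0`. -/
theorem sum_eq_zero_of_isBigO {ι : Type*} (I : Finset ι) (d : ι → ℕ) (a : ι → E) {N : ℕ}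
    (hO : (fun s : ℝ => ∑ i ∈ I, s ^ d i • a i) =O[nhds 0] fun s => s ^ (N + 1)) {n : ℕ}
    (hn : n ≤ N) : ∑ i ∈ I with d i = n, a i = 0 := by
  induction n using Nat.strong_induction_on with
  | _ n ih =>
    set A := ∑ i ∈ I with d i = n, a i with hA
    have h1 : ∀ s : ℝ, ∑ i ∈ I, s ^ d i • a i =
        s ^ n • A + ∑ i ∈ I with n < d i, s ^ d i • a i := by
      intro s
      have h2 : ∑ i ∈ I with d i < n, s ^ d i • a i = 0 := by
        rw [← Finset.sum_fiberwise_of_maps_to (t := Finset.range n) (g := d)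
          (fun i hi => Finset.mem_range.2 (Finset.mem_filter.1 hi).2)]
        refine Finset.sum_eq_zero fun k hk => ?_
        have hk' := Finset.mem_range.1 hk
        have h3 := ih k hk' (hk'.le.trans hn)
        rw [Finset.filter_filter, ← smul_zero (s ^ k), ← h3, Finset.smul_sum]
        refine Finset.sum_congr (Finset.filter_congr fun i _ => ?_) fun i hi => ?_
        · constructor
          · exact fun h => h.2
          · exact fun h => ⟨h ▸ hk', h⟩
        · rw [(Finset.mem_filter.1 hi).2]
      rw [← Finset.sum_filter_add_sum_filter_not I (fun i => d i < n), h2, zero_add,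
        ← Finset.sum_filter_add_sum_filter_not (I.filter fun i => ¬ d i < n) (fun i => d i = n),
        Finset.filter_filter, Finset.filter_filter, hA, Finset.smul_sum]
      congr 1
      · refine Finset.sum_congr (Finset.filter_congr fun i _ => ?_) fun i hi => ?_
        · omega
        · rw [(Finset.mem_filter.1 hi).2]
      · exact Finset.sum_congr (Finset.filter_congr fun i _ => by omega) fun _ _ => rfl
    have h2 : (fun s : ℝ => ∑ i ∈ I with n < d i, s ^ d i • a i) =O[nhds 0]
        fun s => s ^ (n + 1) := by
      refine Asymptotics.IsBigO.fun_sum (A := fun i (s : ℝ) => s ^ d i • a i) fun i hi => ?_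
      have h3 := ((isBigO_pow_pow_zero (Nat.succ_le_of_lt (Finset.mem_filter.1 hi).2)).norm_left
        ).const_mul_left ‖a i‖
      refine Asymptotics.IsBigO.of_norm_left (h3.congr_left fun s => ?_)
      rw [norm_smul, mul_comm]
    have h3 : (fun s : ℝ => s ^ n • A) =O[nhds 0] fun s => s ^ (n + 1) := by
      refine ((hO.trans (isBigO_pow_pow_zero (Nat.succ_le_succ hn))).sub h2).congr_left fun s => ?_
      rw [h1, add_sub_cancel_right]
    obtain ⟨c, hc⟩ := h3.bound
    have h4 : ∀ᶠ s : ℝ in nhdsWithin 0 {0}ᶜ, ‖A‖ ≤ c * ‖s‖ := by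
      filter_upwards [nhdsWithin_le_nhds hc, self_mem_nhdsWithin] with s hs hs0
      have hs' : 0 < ‖s ^ n‖ := norm_pos_iff.2 (pow_ne_zero _ hs0)
      rw [norm_smul, pow_succ, norm_mul, mul_left_comm] at hs
      exact le_of_mul_le_mul_left hs hs'
    have h5 : Filter.Tendsto (fun s : ℝ => c * ‖s‖) (nhdsWithin 0 {0}ᶜ) (nhds 0) := by
      have : Filter.Tendsto (fun s : ℝ => c * ‖s‖) (nhds 0) (nhds (c * ‖(0 : ℝ)‖)) :=
        (continuous_const.mul continuous_norm).tendsto 0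
      rw [norm_zero, mul_zero] at this
      exact this.mono_left nhdsWithin_le_nhds
    exact norm_le_zero_iff.1 (ge_of_tendsto h5 h4)

end Calculus

/-! ### Elementary differentials -/

variable {V : Type} [NormedAddCommGroup V] [NormedSpace ℝ V]

theorem multiDeriv_map_eq {f : V → V} (hf : ContDiff ℝ (⊤ : ℕ∞) f) (x : V)
    (s : Multiset (RTree C)) (v : RTree C → V) :
    multiDeriv f x (s.map v) =
      iteratedFDeriv ℝ s.toList.length f x fun i => v (s.toList.get i) := by
  rw [iteratedFDeriv_apply_eq_multiDeriv hf]
  congr 1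
  conv_lhs => rw [← Multiset.coe_toList s]
  rw [Multiset.map_coe, ← List.ofFn_get s.toList, List.map_ofFn]
  simp

theorem RTree.elemDiff_eq {g : C → V → V} (hg : ∀ c, ContDiff ℝ (⊤ : ℕ∞) (g c)) (τ : RTree C)
    (x : V) : τ.elemDiff g x =
      multiDeriv (g τ.root) x (τ.children.map fun σ => σ.elemDiff g x) := by
  rw [RTree.elemDiff, multiDeriv_map_eq (hg _)]

theorem contDiff_apply_multilinear {p : ℕ} {M : V → V [×p]→L[ℝ] V} {w : Fin p → V → V}
    (hM : ContDiff ℝ (⊤ : ℕ∞) M) (hw : ∀ i, ContDiff ℝ (⊤ : ℕ∞) (w i)) :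
    ContDiff ℝ (⊤ : ℕ∞) fun x => M x fun i => w i x := by
  have h1 : ContDiff ℝ (⊤ : ℕ∞) fun q : (V [×p]→L[ℝ] V) × (Fin p → V) => q.1 q.2 :=
    ((ContinuousLinearMap.id ℝ (V [×p]→L[ℝ] V)).analyticOnNhd_uncurry_of_multilinear
      (s := Set.univ)).contDiff
  exact h1.comp (hM.prodMk (contDiff_pi.2 hw))

theorem RTree.contDiff_elemDiff {g : C → V → V} (hg : ∀ c, ContDiff ℝ (⊤ : ℕ∞) (g c))
    (τ : RTree C) : ContDiff ℝ (⊤ : ℕ∞) (τ.elemDiff g) := by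
  induction h : τ.size using Nat.strong_induction_on generalizing τ with
  | _ n ih =>
    subst h
    have h1 : τ.elemDiff g = fun x => iteratedFDeriv ℝ τ.children.toList.length (g τ.root) x
        fun i => (τ.children.toList.get i).elemDiff g x := funext fun x => by rw [RTree.elemDiff]
    rw [h1]
    exact contDiff_apply_multilinear ((hg _).iteratedFDeriv_right (by exact_mod_cast le_rfl))
      fun i => ih _ (RTree.size_lt (Multiset.mem_toList.1 (List.get_mem _ _))) _ rfl

/-! ### Elementary differentials along a B-series -/

/-- The triples `(τ, ϑ, ω)` with `(ϑ, ω) ∈ ST(τ)`, where `τ` has at most `N` vertices. -/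
noncomputable def triples (C : Type) [Finite C] (N : ℕ) : Finset (Triple C) :=
  (RTree.finite_size_le C N).toFinset.biUnion fun τ => τ.ST.image (Prod.mk τ)

theorem mem_triples [Finite C] {N : ℕ} {t : Triple C} :
    t ∈ triples C N ↔ t.1.size ≤ N ∧ t.2 ∈ t.1.ST := by
  rcases t with ⟨τ, p⟩
  simp only [triples, Finset.mem_biUnion, Set.Finite.mem_toFinset, Set.mem_ofPred_eq,
    Finset.mem_image, Prod.mk.injEq]
  constructor
  · rintro ⟨σ, h1, q, h2, rfl, rfl⟩
    exact ⟨h1, h2⟩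
  · rintro ⟨h1, h2⟩
    exact ⟨τ, h1, p, h2, rfl, rfl⟩

/-- The factor `α(τ) γ(τ, ϑ, ω) ∏_{δ ∈ ω} φ(δ)` that belongs to a triple. -/
noncomputable def Triple.weight (φ : CTree C → ℝ) (t : Triple C) : ℝ :=
  (t.1.alpha : ℝ) * (t.gamma : ℝ) * (t.2.2.map fun δ => φ (some δ)).prod

/-- The term of the triple `(τ, ϑ, ω)` in the expansion of `α(ϑ) F(ϑ)` along a B-series, where
`ε = s` is the parameter of the grading. -/
noncomputable def Triple.term (g : C → V → V) (φ : CTree C → ℝ) (x₀ : V) (s : ℝ)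
    (t : Triple C) : V := (s ^ t.1.size * t.weight φ) • t.1.elemDiff g x₀

/-- The sum of the terms with a given subtree `ϑ`, up to order `N`. -/
noncomputable def termSum [Finite C] (g : C → V → V) (φ : CTree C → ℝ) (x₀ : V) (N : ℕ)
    (ϑ : CTree C) (s : ℝ) : V := ∑ t ∈ triples C N with t.2.1 = ϑ, t.term g φ x₀ s

/-- The term of a multiset of triples at the branches of a root of colour `c`. -/
noncomputable def splitTerm (g : C → V → V) (φ : CTree C → ℝ) (x₀ : V) (c : C) (s : ℝ)
    (u : Multiset (Triple C)) : V :=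
  (s ^ (RTree.node c (u.map Prod.fst)).size * ((multFactorial u : ℝ)⁻¹ *
    (u.map (Triple.weight φ)).prod)) • (RTree.node c (u.map Prod.fst)).elemDiff g x₀

theorem weight_some (φ : CTree C → ℝ) (τ η : RTree C) (ω : Multiset (RTree C)) :
    Triple.weight φ (τ, some η, ω) =
      ∑ u ∈ τ.splittings with joinSubtrees τ.root u = η ∧ joinRemainders u = ω,
        (multFactorial u : ℝ)⁻¹ * (u.map (Triple.weight φ)).prod := by
  simp only [Triple.weight, Triple.gamma]
  rw [RTree.gamma_some, Rat.cast_sum, Finset.mul_sum, Finset.sum_mul]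
  refine Finset.sum_congr rfl fun u hu => ?_
  obtain ⟨hu1, -, rfl⟩ := Finset.mem_filter.1 hu
  have h1 := (RTree.mem_splittings.1 hu1).1
  have h2 : (multFactorial τ.children : ℝ) ≠ 0 := by exact_mod_cast multFactorial_ne_zero _
  have h3 : (multFactorial u : ℝ) ≠ 0 := by exact_mod_cast multFactorial_ne_zero _
  have h4 : (τ.children.map RTree.alpha).prod = (u.map fun t => t.1.alpha).prod := by
    rw [← h1, Multiset.map_map]; rfl
  have h5 : ∀ f : Triple C → ℚ, (((u.map f).prod : ℚ) : ℝ) = (u.map fun t => (f t : ℝ)).prod := by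
    intro f
    have := map_multiset_prod (Rat.castHom ℝ) (u.map f)
    rw [Multiset.map_map] at this
    exact this
  have h6 : (u.map (Triple.weight φ)).prod = (u.map fun t => (t.1.alpha : ℝ)).prod *
      (u.map fun t => (t.gamma : ℝ)).prod *
        (u.map fun t => (t.2.2.map fun δ => φ (some δ)).prod).prod := by
    rw [← Multiset.prod_map_mul, ← Multiset.prod_map_mul]
    rfl
  rw [RTree.alpha_eq, h4, prod_map_joinRemainders, Rat.cast_mul, Rat.cast_mul, h5, h5,
    h6]
  push_cast
  field_simp

theorem filterMap_map_some_add_replicate {α : Type*} [DecidableEq α] (m : Multiset (Option α)) :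
    (m.filterMap id).map some + Multiset.replicate (m.count none) none = m := by
  induction m using Multiset.induction_on with
  | empty => simp
  | cons a m ih =>
    rcases a with _ | a
    · rw [Multiset.filterMap_cons_none _ _ rfl, Multiset.count_cons_self, Multiset.replicate_succ,
        Multiset.add_cons, ih]
    · rw [Multiset.filterMap_cons_some id (some a) m (b := a) rfl, Multiset.map_cons,
        Multiset.cons_add, Multiset.count_cons_of_ne (by simp), ih]

theorem filterMap_eq_iff {u : Multiset (Triple C)} {S : Multiset (RTree C)} {j : ℕ} :
    u.map (fun t => t.2.1) = S.map some + Multiset.replicate j none ↔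
      u.filterMap (fun t => t.2.1) = S ∧ (u.map fun t => t.2.1).count none = j := by
  have h1 : u.filterMap (fun t => t.2.1) = (u.map fun t => t.2.1).filterMap id := by
    rw [Multiset.filterMap_map]; rfl
  rw [h1]
  constructor
  · intro h
    rw [h, Multiset.filterMap_add, Multiset.filterMap_map, Multiset.count_add]
    constructor
    · have h2 : (Multiset.replicate j (none : Option (RTree C))).filterMap id = 0 :=
        Multiset.eq_zero_of_forall_notMem fun a ha => by
          obtain ⟨b, hb, hb'⟩ := (Multiset.mem_filterMap _ _).1 ha
          rw [Multiset.eq_of_mem_replicate hb] at hb'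
          cases hb'
      rw [h2, add_zero]
      exact Multiset.filterMap_some S
    · rw [Multiset.count_eq_zero_of_notMem (by simp), zero_add, Multiset.count_replicate_self]
  · rintro ⟨h2, h3⟩
    rw [← h2, ← h3, filterMap_map_some_add_replicate]

theorem size_node (c : C) (s : Multiset (RTree C)) :
    (RTree.node c s).size = 1 + (s.map RTree.size).sum := by
  rw [RTree.size_eq, RTree.children_node]

/-- The terms of the triples with subtree `η`, resolved into the splittings of the branches. -/
theorem termSum_some [Finite C] (g : C → V → V) (φ : CTree C → ℝ) (x₀ : V) (N : ℕ)
    (η : RTree C) (s : ℝ) :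
    termSum g φ x₀ N (some η) s = ∑ j ∈ Finset.range (N + 1),
      ∑ u ∈ (keyedMultisets (triples C N) (fun t => t.2.1)
        (η.children.map some + Multiset.replicate j none)) with
          (RTree.node η.root (u.map Prod.fst)).size ≤ N, splitTerm g φ x₀ η.root s u := by
  have h1 : ∀ t ∈ (triples C N).filter fun t => t.2.1 = some η, t.term g φ x₀ s =
      ∑ u ∈ t.1.splittings with joinSubtrees t.1.root u = η ∧ joinRemainders u = t.2.2,
        splitTerm g φ x₀ η.root s u := by
    rintro ⟨τ, ϑ, ω⟩ ht
    obtain rfl : ϑ = some η := (Finset.mem_filter.1 ht).2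
    rw [Triple.term, weight_some, Finset.mul_sum, Finset.sum_smul]
    refine Finset.sum_congr rfl fun u hu => ?_
    obtain ⟨hu1, hu2, -⟩ := Finset.mem_filter.1 hu
    have h2 : RTree.node η.root (u.map Prod.fst) = τ := by
      rw [(RTree.mem_splittings.1 hu1).1, ← hu2]
      exact τ.node_eta
    rw [splitTerm, h2]
  rw [termSum, Finset.sum_congr rfl h1, Finset.sum_sigma', Finset.sum_sigma']
  refine Finset.sum_nbij' (fun y => ⟨(y.2.map fun t => t.2.1).count none, y.2⟩)
    (fun z => ⟨(RTree.node η.root (z.2.map Prod.fst), some η, joinRemainders z.2), z.2⟩)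
    ?_ ?_ ?_ ?_ fun _ _ => rfl
  · rintro ⟨⟨τ, ϑ, ω⟩, u⟩ hy
    simp only [Finset.mem_sigma, Finset.mem_filter, mem_triples] at hy ⊢
    obtain ⟨⟨⟨hτ, -⟩, rfl⟩, hu1, hu2, rfl⟩ := hy
    obtain ⟨h2, h3⟩ := RTree.mem_splittings.1 hu1
    have h4 : RTree.node η.root (u.map Prod.fst) = τ := by
      rw [h2, ← hu2]
      exact τ.node_eta
    refine ⟨?_, mem_keyedMultisets.2 ⟨filterMap_eq_iff.2 ⟨?_, rfl⟩, fun t ht => ?_⟩, ?_⟩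
    · rw [Finset.mem_range, Nat.lt_succ_iff]
      refine (Multiset.count_le_card _ _).trans ?_
      have h5 := Multiset.card_nsmul_le_sum (s := τ.children.map RTree.size) (a := 1) (by
        intro x hx
        obtain ⟨σ, -, rfl⟩ := Multiset.mem_map.1 hx
        exact σ.size_pos)
      have h6 := congrArg Multiset.card h2
      have h7 := τ.size_eq
      simp only [Multiset.card_map, smul_eq_mul, mul_one] at h5 h6 ⊢
      omega
    · rw [← hu2, joinSubtrees_children]
    · refine mem_triples.2 ⟨?_, h3 t ht⟩
      have := RTree.size_lt (h2 ▸ Multiset.mem_map_of_mem Prod.fst ht)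
      omega
    · rw [h4]
      exact hτ
  · rintro ⟨j, u⟩ hz
    simp only [Finset.mem_sigma, Finset.mem_filter, mem_triples, mem_keyedMultisets] at hz ⊢
    obtain ⟨-, ⟨h2, h3⟩, h4⟩ := hz
    have h5 : u ∈ (RTree.node η.root (u.map Prod.fst)).splittings :=
      RTree.mem_splittings.2 ⟨(RTree.children_node _ _).symm, fun t ht => (h3 t ht).2⟩
    have h6 : joinSubtrees (RTree.node η.root (u.map Prod.fst)).root u = η := by
      rw [RTree.root_node, joinSubtrees, (filterMap_eq_iff.1 h2).1]
      exact η.node_eta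
    exact ⟨⟨⟨h4, RTree.mem_ST_some.2 ⟨u, h5, h6, rfl⟩⟩, trivial⟩, h5, h6, trivial⟩
  · rintro ⟨⟨τ, ϑ, ω⟩, u⟩ hy
    simp only [Finset.mem_sigma, Finset.mem_filter, mem_triples] at hy
    obtain ⟨⟨⟨hτ, -⟩, rfl⟩, hu1, hu2, rfl⟩ := hy
    have h4 : RTree.node η.root (u.map Prod.fst) = τ := by
      rw [(RTree.mem_splittings.1 hu1).1, ← hu2]
      exact τ.node_eta
    simp only [h4]
  · rintro ⟨j, u⟩ hz
    simp only [Finset.mem_sigma, Finset.mem_filter, mem_keyedMultisets] at hz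
    obtain ⟨-, ⟨h2, -⟩, -⟩ := hz
    simp only [(filterMap_eq_iff.1 h2).2]

theorem continuous_termSum [Finite C] (g : C → V → V) (φ : CTree C → ℝ) (x₀ : V) (N : ℕ)
    (ϑ : CTree C) :
    Continuous (termSum g φ x₀ N ϑ) := by
  unfold termSum Triple.term
  fun_prop

theorem smul_pow_isBigO {m n : ℕ} (h : m ≤ n) (b : ℝ) (a : V) :
    (fun s : ℝ => (s ^ n * b) • a) =O[nhds 0] fun s => s ^ m := by
  have h1 := ((isBigO_pow_pow_zero h).norm_left).const_mul_left (‖b‖ * ‖a‖)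
  refine Asymptotics.IsBigO.of_norm_left (h1.congr_left fun s => ?_)
  rw [norm_smul, norm_mul]
  ring

theorem termSum_isBigO_id [Finite C] (g : C → V → V) (φ : CTree C → ℝ) (x₀ : V) (N : ℕ)
    (ϑ : CTree C) :
    (termSum g φ x₀ N ϑ) =O[nhds 0] fun s => s := by
  refine Asymptotics.IsBigO.fun_sum (A := fun (t : Triple C) s => t.term g φ x₀ s) fun t _ => ?_
  exact (smul_pow_isBigO (m := 1) t.1.size_pos (t.weight φ) (t.1.elemDiff g x₀)).congr_right
    fun s => pow_one s

theorem prod_map_pow_eq (s : ℝ) {ι : Type*} (u : Multiset ι) (d : ι → ℕ) :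
    (u.map fun i => s ^ d i).prod = s ^ (u.map d).sum := by
  induction u using Multiset.induction_on with
  | empty => simp
  | cons i u ih => simp [ih, pow_add]

theorem multFactorial_add_replicate (S : Multiset (RTree C)) (j : ℕ) :
    multFactorial (S.map some + Multiset.replicate j (none : CTree C)) =
      multFactorial S * j.factorial := by
  induction j with
  | zero => simp [multFactorial_map (Option.some_injective _)]
  | succ j ih =>
    rw [Multiset.replicate_succ, Multiset.add_cons, multFactorial_cons, ih, Multiset.count_add,
      Multiset.count_eq_zero_of_notMem (by simp), Multiset.count_replicate_self,
      Nat.factorial_succ]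
    push_cast
    ring

/-- The terms of the Taylor expansion of `g_c^{(κ)}` at `x₀` are expanded into multisets of
triples: a branch `ϑ` of `η` is the subtree of some of them, and the increment of the argument
yields triples `(δ, ∅, {δ})`. -/
theorem smul_multiDeriv_termSum [Finite C] {g : C → V → V} (hg : ∀ c, ContDiff ℝ (⊤ : ℕ∞) (g c))
    (φ : CTree C → ℝ) (x₀ : V) (N : ℕ) (c : C) (S : Multiset (RTree C)) (j : ℕ) (s : ℝ) :
    s • (multFactorial S : ℝ)⁻¹ • (j.factorial : ℝ)⁻¹ • multiDeriv (g c) x₀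
      ((S.map fun σ => termSum g φ x₀ N (some σ) s) +
        Multiset.replicate j (termSum g φ x₀ N none s)) =
      ∑ u ∈ keyedMultisets (triples C N) (fun t => t.2.1)
        (S.map some + Multiset.replicate j none), splitTerm g φ x₀ c s u := by
  have h1 := multiDeriv_expand (hg c) x₀ (triples C N) (fun t : Triple C => t.2.1)
    (fun t => t.term g φ x₀ s) (S.map some + Multiset.replicate j none) 0
  simp only [add_zero, Multiset.map_add, Multiset.map_map, Multiset.map_replicate,
    multFactorial_add_replicate, Rat.cast_mul, Rat.cast_natCast, mul_inv, mul_smul] at h1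
  change (multFactorial S : ℝ)⁻¹ • (j.factorial : ℝ)⁻¹ • multiDeriv (g c) x₀
      ((S.map fun σ => termSum g φ x₀ N (some σ) s) +
        Multiset.replicate j (termSum g φ x₀ N none s)) = _ at h1
  rw [h1, Finset.smul_sum]
  refine Finset.sum_congr rfl fun u _ => ?_
  have h2 : u.map (fun t => t.term g φ x₀ s) = u.map fun t : Triple C =>
      (s ^ t.1.size * t.weight φ) • t.1.elemDiff g x₀ := rfl
  rw [h2, multiDeriv_map_smul (hg c), Multiset.prod_map_mul, prod_map_pow_eq, splitTerm,
    RTree.elemDiff_eq hg, RTree.children_node, RTree.root_node, size_node, Multiset.map_map,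
    Multiset.map_map, smul_smul, smul_smul]
  congr 1
  rw [pow_add, pow_one]
  simp only [Function.comp_def]
  ring

theorem smul_elemDiff_eq {g : C → V → V} (hg : ∀ c, ContDiff ℝ (⊤ : ℕ∞) (g c)) (η : RTree C)
    (x : V) (s : ℝ) : s ^ η.size • (η.alpha : ℝ) • η.elemDiff g x =
      s • (multFactorial η.children : ℝ)⁻¹ • multiDeriv (g η.root) x
        (η.children.map fun σ => s ^ σ.size • (σ.alpha : ℝ) • σ.elemDiff g x) := by
  have h1 : ((η.children.map RTree.alpha).prod : ℝ) =
      (η.children.map fun σ => (σ.alpha : ℝ)).prod := by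
    have := map_multiset_prod (Rat.castHom ℝ) (η.children.map RTree.alpha)
    rw [Multiset.map_map] at this
    exact this
  simp_rw [smul_smul]
  rw [multiDeriv_map_smul (hg _), ← RTree.elemDiff_eq hg, Multiset.prod_map_mul, prod_map_pow_eq,
    RTree.alpha_eq, smul_smul, Rat.cast_mul, h1, η.size_eq, pow_add, pow_one]
  congr 1
  push_cast
  ring

/-- Along the curve `x₀ + ∑ ε^{|δ|} α(δ) φ(δ) F(δ)(x₀)`, the elementary differential
`α(η) F(η)`, taken for `ε g` in place of `g`, is the sum of the terms of the triples
`(τ, η, ω)`. The induction uses the Taylor expansion of the vector field at the root. -/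
theorem elemDiff_sub_termSum_isBigO [Finite C] [CompleteSpace V] {g : C → V → V}
    (hg : ∀ c, ContDiff ℝ (⊤ : ℕ∞) (g c)) (φ : CTree C → ℝ) (x₀ : V) (N : ℕ) (η : RTree C) :
    (fun s : ℝ => s ^ η.size • (η.alpha : ℝ) • η.elemDiff g (x₀ + termSum g φ x₀ N none s) -
      termSum g φ x₀ N (some η) s) =O[nhds 0] fun s => s ^ (N + 1) := by
  induction h : η.size using Nat.strong_induction_on generalizing η with
  | _ n ih =>
  subst h
  -- `u` and `w` are the two sides at the branches, `M` is the derivative of the vector field at the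
  -- point of the curve, and `P` its Taylor polynomial at `x₀`.
  let v := termSum g φ x₀ N none
  let p := η.children.toList.length
  let ch : Fin p → RTree C := η.children.toList.get
  let f := g η.root
  let u : RTree C → ℝ → V := fun σ s => s ^ σ.size • (σ.alpha : ℝ) • σ.elemDiff g (x₀ + v s)
  let w : RTree C → ℝ → V := fun σ => termSum g φ x₀ N (some σ)
  let M : ℝ → V [×p]→L[ℝ] V := fun s => iteratedFDeriv ℝ p f (x₀ + v s)
  let P : ℝ → V [×p]→L[ℝ] V := fun s => ∑ j ∈ Finset.range (N + 1),
    (j.factorial : ℝ)⁻¹ • iteratedFDeriv ℝ j (iteratedFDeriv ℝ p f) x₀ fun _ => v s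
  have hv : Continuous v := continuous_termSum g φ x₀ N none
  have hfp : ContDiff ℝ (⊤ : ℕ∞) (iteratedFDeriv ℝ p f) :=
    (hg _).iteratedFDeriv_right (by exact_mod_cast le_rfl)
  have hcont : ∀ {W : Type} [NormedAddCommGroup W] (q : ℝ → W), Continuous q →
      q =O[nhds 0] fun _ => (1 : ℝ) := fun q hq => (hq.tendsto 0).isBigO_one ℝ
  have hM : Continuous M := hfp.continuous.comp (continuous_const.add hv)
  have hu : ∀ σ, Continuous (u σ) := fun σ => by
    have := (σ.contDiff_elemDiff hg).continuous.comp (continuous_const.add hv : Continuous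
      fun s => x₀ + v s)
    exact (continuous_pow _).smul (continuous_const.smul this)
  have hw : ∀ σ, Continuous (w σ) := fun σ => continuous_termSum g φ x₀ N (some σ)
  have h1 : (fun s => M s (fun i => u (ch i) s) - M s fun i => w (ch i) s) =O[nhds 0]
      fun s => s ^ (N + 1) :=
    isBigO_apply_sub (u := fun i => u (ch i)) (w := fun i => w (ch i)) (hcont _ hM)
      (fun i => hcont _ (hu _)) (fun i => hcont _ (hw _)) fun i =>
        ih _ (RTree.size_lt (Multiset.mem_toList.1 (List.get_mem _ _))) _ rfl
  have h2 : (fun s => (M s - P s) fun i => w (ch i) s) =O[nhds 0] fun s => s ^ (N + 1) := by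
    have hv1 : v =O[nhds 0] fun s => s := termSum_isBigO_id g φ x₀ N none
    refine isBigO_apply (w := fun i => w (ch i)) ?_ fun i => hcont _ (hw _)
    exact ((taylor_isBigO hfp x₀ N).comp_tendsto (hv1.trans_tendsto Filter.tendsto_id)).trans
      (hv1.norm_left.pow (N + 1))
  have h3 : (fun s => s • (multFactorial η.children : ℝ)⁻¹ •
      (M s (fun i => u (ch i) s) - P s fun i => w (ch i) s)) =O[nhds 0] fun s => s ^ (N + 1) := by
    have h4 : (fun s => M s (fun i => u (ch i) s) - P s fun i => w (ch i) s) =O[nhds 0]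
        fun s => s ^ (N + 1) := (h1.add h2).congr_left fun s => by
      rw [_root_.sub_apply, sub_add_sub_cancel]
    have h5 : (fun s : ℝ => s) =O[nhds 0] fun _ => (1 : ℝ) := hcont _ continuous_id
    simpa using h5.smul (h4.const_smul_left (multFactorial η.children : ℝ)⁻¹)
  have h4 : ∀ s, s ^ η.size • (η.alpha : ℝ) • η.elemDiff g (x₀ + v s) =
      s • (multFactorial η.children : ℝ)⁻¹ • M s fun i => u (ch i) s := fun s => by
    rw [smul_elemDiff_eq hg, multiDeriv_map_eq (hg _)]
  have h5 : ∀ s, s • (multFactorial η.children : ℝ)⁻¹ • (P s fun i => w (ch i) s) =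
      termSum g φ x₀ N (some η) s + ∑ j ∈ Finset.range (N + 1),
      ∑ u ∈ (keyedMultisets (triples C N) (fun t => t.2.1)
        (η.children.map some + Multiset.replicate j none)) with
          ¬ (RTree.node η.root (u.map Prod.fst)).size ≤ N, splitTerm g φ x₀ η.root s u := by
    intro s
    rw [termSum_some, ← Finset.sum_add_distrib]
    simp only [P, _root_.sum_apply, _root_.smul_apply,
      Finset.smul_sum]
    refine Finset.sum_congr rfl fun j _ => ?_
    rw [Finset.sum_filter_add_sum_filter_not, ← smul_multiDeriv_termSum hg,
      iteratedFDeriv_iteratedFDeriv_apply (hg _)]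
    have h6 : (List.ofFn fun i => w (ch i) s : Multiset V) =
        η.children.map fun σ => termSum g φ x₀ N (some σ) s := by
      conv_rhs => rw [← Multiset.coe_toList η.children]
      rw [Multiset.map_coe, ← List.ofFn_get η.children.toList, List.map_ofFn]
      simp [ch, w, p]
    rw [h6]
  have h6 : (fun s => ∑ j ∈ Finset.range (N + 1),
      ∑ u ∈ (keyedMultisets (triples C N) (fun t => t.2.1)
        (η.children.map some + Multiset.replicate j none)) with
          ¬ (RTree.node η.root (u.map Prod.fst)).size ≤ N, splitTerm g φ x₀ η.root s u)
      =O[nhds 0] fun s => s ^ (N + 1) := by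
    refine Asymptotics.IsBigO.fun_sum fun j _ => Asymptotics.IsBigO.fun_sum fun u hu => ?_
    exact smul_pow_isBigO (not_le.1 (Finset.mem_filter.1 hu).2) _ _
  refine (h3.add h6).congr_left fun s => ?_
  change _ = s ^ η.size • (η.alpha : ℝ) • η.elemDiff g (x₀ + v s) - _
  rw [h4, smul_sub, smul_sub, h5]
  abel

/-! ### Composition of formal B-series -/

/-- The nonempty trees with exactly `n` vertices. -/
noncomputable def rtreesOfSize (C : Type) [Finite C] (n : ℕ) : Finset (RTree C) :=
  (RTree.finite_size_le C n).toFinset.filter fun τ => τ.size = n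

theorem mem_rtreesOfSize [Finite C] {n : ℕ} {τ : RTree C} : τ ∈ rtreesOfSize C n ↔ τ.size = n := by
  simp only [rtreesOfSize, Finset.mem_filter, Set.Finite.mem_toFinset, Set.mem_ofPred_eq,
    and_iff_right_iff_imp]
  exact fun h => h.le

theorem mem_treesOfSize [Finite C] {n : ℕ} {τ : CTree C} :
    τ ∈ treesOfSize C n ↔ numVertices τ = n := by
  simp [treesOfSize]

theorem sum_treesOfSize [Finite C] {M : Type*} [AddCommMonoid M] {n : ℕ} (f : CTree C → M)
    (hf : f none = 0) : ∑ τ ∈ treesOfSize C n, f τ = ∑ τ ∈ rtreesOfSize C n, f (some τ) := by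
  have h1 : (rtreesOfSize C n).map Function.Embedding.some ⊆ treesOfSize C n := by
    intro τ hτ
    obtain ⟨σ, hσ, rfl⟩ := Finset.mem_map.1 hτ
    exact mem_treesOfSize.2 (mem_rtreesOfSize.1 hσ)
  rw [← Finset.sum_subset h1, Finset.sum_map]
  · rfl
  · rintro (_ | τ) h2 h3
    · exact hf
    · exact absurd (Finset.mem_map_of_mem _ (mem_rtreesOfSize.2 (mem_treesOfSize.1 h2))) h3

theorem bseries_eq_sum_rtreesOfSize [Finite C] (g : C → V → V) {χ : CTree C → ℝ} (x₀ : V) {n : ℕ}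
    (h : χ none = 0 ∨ n ≠ 0) : bseries g χ x₀ n =
      ∑ τ ∈ rtreesOfSize C n, ((τ.alpha : ℝ) * χ (some τ)) • τ.elemDiff g x₀ := by
  have h1 : bseries g χ x₀ n = ∑ τ ∈ treesOfSize C n,
      if τ = none then 0 else ((alpha τ : ℝ) * χ τ) • elemDiff g τ x₀ := by
    refine Finset.sum_congr rfl fun τ hτ => ?_
    split_ifs with h2
    · subst h2
      rcases h with h | h
      · rw [h, mul_zero, zero_smul]
      · exact absurd (mem_treesOfSize.1 hτ).symm h
    · rfl
  rw [h1, sum_treesOfSize (fun τ => if τ = none then 0 else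
    ((alpha τ : ℝ) * χ τ) • elemDiff g τ x₀) (if_pos rfl)]
  exact Finset.sum_congr rfl fun τ _ => if_neg (Option.some_ne_none τ)

theorem bseries_zero [Finite C] (g : C → V → V) {φ : CTree C → ℝ} (x₀ : V) :
    bseries g φ x₀ 0 = φ none • x₀ := by
  have h1 : treesOfSize C 0 = {none} := by
    ext τ
    rw [mem_treesOfSize, Finset.mem_singleton]
    rcases τ with _ | τ
    · simp [numVertices]
    · simpa [numVertices] using τ.size_pos.ne'
  rw [bseries, h1, Finset.sum_singleton]
  simp [alpha, elemDiff]

theorem sum_triples [Finite C] {M : Type*} [AddCommMonoid M] (N : ℕ) (f : Triple C → M) :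
    ∑ t ∈ triples C N, f t =
      ∑ τ ∈ (RTree.finite_size_le C N).toFinset, ∑ p ∈ τ.ST, f (τ, p) := by
  rw [triples, Finset.sum_biUnion]
  · exact Finset.sum_congr rfl fun τ _ => Finset.sum_image fun p _ q _ h => (Prod.mk.inj h).2
  · intro τ _ σ _ h
    refine Finset.disjoint_left.2 fun t ht ht' => h ?_
    obtain ⟨p, -, rfl⟩ := Finset.mem_image.1 ht
    obtain ⟨q, -, h2⟩ := Finset.mem_image.1 ht'
    exact (congrArg Prod.fst h2).symm

theorem sum_size_le [Finite C] {M : Type*} [AddCommMonoid M] (N : ℕ) (f : RTree C → M) :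
    ∑ τ ∈ (RTree.finite_size_le C N).toFinset, f τ =
      ∑ n ∈ Finset.Icc 1 N, ∑ τ ∈ rtreesOfSize C n, f τ := by
  rw [← Finset.sum_fiberwise_of_maps_to (g := RTree.size) (t := Finset.Icc 1 N)]
  · refine Finset.sum_congr rfl fun n hn => Finset.sum_congr ?_ fun _ _ => rfl
    ext τ
    have := (Finset.mem_Icc.1 hn).2
    simp only [Finset.mem_filter, Set.Finite.mem_toFinset, Set.mem_ofPred_eq, mem_rtreesOfSize]
    omega
  · intro τ hτ
    rw [Set.Finite.mem_toFinset] at hτ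
    exact Finset.mem_Icc.2 ⟨τ.size_pos, hτ⟩

theorem termSum_none [Finite C] (g : C → V → V) (φ : CTree C → ℝ) (x₀ : V) (N : ℕ) (s : ℝ) :
    termSum g φ x₀ N none s = ∑ n ∈ Finset.Icc 1 N, s ^ n • bseries g φ x₀ n := by
  rw [termSum, Finset.sum_filter, sum_triples, sum_size_le]
  refine Finset.sum_congr rfl fun n hn => ?_
  have hn' := (Finset.mem_Icc.1 hn).1
  rw [bseries_eq_sum_rtreesOfSize g x₀ (Or.inr (by omega)), Finset.smul_sum]
  refine Finset.sum_congr rfl fun τ hτ => ?_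
  rw [Finset.sum_eq_single_of_mem (none, {τ}) (RTree.mem_ST_none.2 rfl)]
  · rw [if_pos rfl, smul_smul, Triple.term, Triple.weight, Triple.gamma, RTree.gamma_none,
      mem_rtreesOfSize.1 hτ]
    simp
  · rintro ⟨_ | η, ω⟩ hp hne
    · exact absurd (by rw [RTree.mem_ST_none.1 hp]) hne
    · exact if_neg (Option.some_ne_none η)

/-- Expansion of an elementary differential at a formal B-series: comparison of coefficients in
the expansion along the curve `∑ εⁿ Y n`. -/
theorem alpha_smul_formalEval [Finite C] [CompleteSpace V] {g : C → V → V}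
    (hg : ∀ c, ContDiff ℝ (⊤ : ℕ∞) (g c)) {φ : CTree C → ℝ} (hφ : φ none = 1) (x₀ : V)
    (η : RTree C) (m : ℕ) :
    (η.alpha : ℝ) • formalEval (η.elemDiff g) (bseries g φ x₀) m =
      ∑ τ ∈ rtreesOfSize C (η.size + m), ∑ p ∈ τ.ST with p.1 = some η,
        Triple.weight φ (τ, p) • τ.elemDiff g x₀ := by
  set N := η.size + m with hN
  set Y := bseries g φ x₀ with hY
  have hY0 : Y 0 = x₀ := by rw [hY, bseries_zero, hφ, one_smul]
  have h1 := elemDiff_sub_termSum_isBigO hg φ x₀ N η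
  have h2 := formalEval_isBigO (η.contDiff_elemDiff hg) Y N
  have h3 : (fun s : ℝ => s ^ η.size • (η.alpha : ℝ) • (η.elemDiff g (Y 0 +
      ∑ n ∈ Finset.Icc 1 N, s ^ n • Y n) - ∑ n ∈ Finset.range (N + 1),
        s ^ n • formalEval (η.elemDiff g) Y n)) =O[nhds 0] fun s => s ^ (N + 1) := by
    have h5 : (fun s : ℝ => s ^ η.size) =O[nhds 0] fun _ => (1 : ℝ) :=
      ((continuous_pow η.size).tendsto 0).isBigO_one ℝ
    simpa using h5.smul (h2.const_smul_left (η.alpha : ℝ))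
  -- Both expansions are written as one polynomial curve, to compare the coefficients of `s ^ N`.
  let d : ℕ ⊕ Triple C → ℕ := Sum.elim (fun n => η.size + n) fun t => t.1.size
  let a : ℕ ⊕ Triple C → V := Sum.elim (fun n => (η.alpha : ℝ) • formalEval (η.elemDiff g) Y n)
    fun t => -(t.weight φ • t.1.elemDiff g x₀)
  let I : Finset (ℕ ⊕ Triple C) :=
    (Finset.range (N + 1)).disjSum ((triples C N).filter fun t => t.2.1 = some η)
  have h4 : (fun s : ℝ => ∑ i ∈ I, s ^ d i • a i) =O[nhds 0] fun s => s ^ (N + 1) := by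
    refine (h1.sub h3).congr_left fun s => ?_
    rw [hY0, ← termSum_none, smul_sub, smul_sub, Finset.sum_disjSum]
    simp only [d, a, Sum.elim_inl, Sum.elim_inr, smul_neg, Finset.sum_neg_distrib]
    have h6 : termSum g φ x₀ N (some η) s = ∑ t ∈ triples C N with t.2.1 = some η,
        s ^ t.1.size • t.weight φ • t.1.elemDiff g x₀ :=
      Finset.sum_congr rfl fun t _ => by rw [smul_smul]; rfl
    have h7 : s ^ η.size • (η.alpha : ℝ) • ∑ n ∈ Finset.range (N + 1),
        s ^ n • formalEval (η.elemDiff g) Y n = ∑ n ∈ Finset.range (N + 1),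
          s ^ (η.size + n) • (η.alpha : ℝ) • formalEval (η.elemDiff g) Y n := by
      rw [Finset.smul_sum, Finset.smul_sum]
      refine Finset.sum_congr rfl fun n _ => ?_
      simp only [smul_smul]
      congr 1
      ring
    rw [h6, h7]
    abel
  have h5 : (∑ n ∈ Finset.range (N + 1), if η.size + n = N then
      (η.alpha : ℝ) • formalEval (η.elemDiff g) Y n else 0) +
      ∑ t ∈ triples C N with t.2.1 = some η,
        (if t.1.size = N then -(t.weight φ • t.1.elemDiff g x₀) else 0) = 0 := by
    have h6 := sum_eq_zero_of_isBigO I d a h4 le_rfl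
    rw [Finset.sum_filter, Finset.sum_disjSum] at h6
    exact h6
  rw [Finset.sum_eq_single_of_mem m (Finset.mem_range.2 (by omega)) fun n _ hne =>
    if_neg (by omega), if_pos rfl, Finset.sum_filter, sum_triples] at h5
  rw [eq_neg_of_add_eq_zero_left h5, rtreesOfSize, Finset.sum_filter, ← Finset.sum_neg_distrib]
  refine Finset.sum_congr rfl fun τ _ => ?_
  rw [Finset.sum_filter]
  by_cases h6 : τ.size = N
  · rw [if_pos h6, ← Finset.sum_neg_distrib]
    refine Finset.sum_congr rfl fun p _ => ?_
    simp only [if_pos h6]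
    split_ifs <;> simp
  · simp [h6]

theorem alpha_smul_compose (φ ψ : CTree C → ℝ) (τ : RTree C) :
    (τ.alpha : ℝ) * compose φ ψ (some τ) =
      ∑ p ∈ τ.ST, ψ p.1 * Triple.weight φ (τ, p) := by
  rw [compose, Finset.mul_sum]
  refine Finset.sum_congr rfl fun p _ => ?_
  rw [Rat.smul_def, Triple.weight]
  change (τ.alpha : ℝ) * ((τ.gamma p.1 p.2 : ℝ) * _) = ψ p.1 * (τ.alpha * (τ.gamma p.1 p.2 : ℝ) * _)
  ring

theorem alpha_smul_starProd (φ ψ : CTree C → ℝ) (τ : RTree C) :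
    (τ.alpha : ℝ) * starProd φ ψ (some τ) =
      ∑ p ∈ τ.ST, ψ p.1 * if p.2.card = 1 then Triple.weight φ (τ, p) else 0 := by
  rw [starProd_some, Finset.mul_sum]
  refine Finset.sum_congr rfl fun p _ => ?_
  split_ifs with h
  · obtain ⟨δ, hδ⟩ := Multiset.card_eq_one.1 h
    rw [Rat.smul_def, Triple.weight]
    change (τ.alpha : ℝ) * ((τ.gamma p.1 p.2 : ℝ) * _) =
      ψ p.1 * (τ.alpha * (τ.gamma p.1 p.2 : ℝ) * _)
    simp only [hδ, Multiset.map_singleton, Multiset.sum_singleton, Multiset.prod_singleton]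
    ring
  · simp

/-- Sorting the pairs of `ST(τ)` by the size of the subtree. -/
theorem sum_antidiagonal_ST [Finite C] {M : Type*} [AddCommMonoid M] (n : ℕ)
    (Q : RTree C → CTree C × Multiset (RTree C) → M) :
    ∑ p ∈ Finset.HasAntidiagonal.antidiagonal n, ∑ ϑ ∈ treesOfSize C p.1,
      ∑ τ ∈ rtreesOfSize C n, ∑ q ∈ τ.ST with q.1 = ϑ, Q τ q =
    ∑ τ ∈ rtreesOfSize C n, ∑ q ∈ τ.ST, Q τ q := by
  rw [Finset.sum_sigma', Finset.sum_comm]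
  refine Finset.sum_congr rfl fun τ hτ => ?_
  simp_rw [Finset.sum_filter]
  rw [Finset.sum_comm]
  refine Finset.sum_congr rfl fun q hq => ?_
  have h1 := RTree.numVertices_add_of_mem_ST hq
  rw [mem_rtreesOfSize.1 hτ] at h1
  rw [Finset.sum_eq_single_of_mem ⟨(numVertices q.1, (q.2.map RTree.size).sum), q.1⟩, if_pos rfl]
  · exact Finset.mem_sigma.2 ⟨Finset.HasAntidiagonal.mem_antidiagonal.2 h1, mem_treesOfSize.2 rfl⟩
  · rintro ⟨⟨a, b⟩, ϑ⟩ h2 hne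
    refine if_neg fun h3 => hne ?_
    simp only [Finset.mem_sigma, Finset.HasAntidiagonal.mem_antidiagonal, mem_treesOfSize] at h2
    subst h3
    obtain ⟨h4, rfl⟩ := h2
    obtain rfl : b = (q.2.map RTree.size).sum := by omega
    rfl

/-- The B-series `B(ψ, ·)` at the B-series `B(φ, x₀)` is the B-series with weights `φ ∘ ψ`. -/
theorem bseriesAt_bseries [Finite C] [CompleteSpace V] {g : C → V → V}
    (hg : ∀ c, ContDiff ℝ (⊤ : ℕ∞) (g c)) {φ ψ : CTree C → ℝ} (hφ : φ none = 1)
    (hψ : ψ none = 0) (x₀ : V) :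
    bseriesAt g ψ (bseries g φ x₀) = bseries g (compose φ ψ) x₀ := by
  funext n
  rw [bseries_eq_sum_rtreesOfSize g x₀ (Or.inl (by rw [compose_none, hψ]))]
  simp_rw [alpha_smul_compose, Finset.sum_smul]
  rw [← sum_antidiagonal_ST n, bseriesAt]
  refine Finset.sum_congr rfl fun p hp => Finset.sum_congr rfl fun ϑ hϑ => ?_
  rw [← Finset.HasAntidiagonal.mem_antidiagonal.1 hp, ← mem_treesOfSize.1 hϑ]
  rcases ϑ with _ | η
  · rw [hψ, mul_zero, zero_smul]
    refine (Finset.sum_eq_zero fun τ _ => Finset.sum_eq_zero fun q hq => ?_).symm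
    rw [(Finset.mem_filter.1 hq).2, hψ, zero_mul, zero_smul]
  · rw [mul_comm, mul_smul]
    change ψ (some η) • (η.alpha : ℝ) • formalEval (η.elemDiff g) _ _ = _
    rw [alpha_smul_formalEval hg hφ, Finset.smul_sum]
    refine Finset.sum_congr rfl fun τ _ => ?_
    rw [Finset.smul_sum]
    refine Finset.sum_congr rfl fun q hq => ?_
    rw [(Finset.mem_filter.1 hq).2, smul_smul]

/-- The part of `alpha_smul_formalEval` that is linear in the weights. -/
theorem alpha_smul_fderiv_bseries [Finite C] [CompleteSpace V] {g : C → V → V}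
    (hg : ∀ c, ContDiff ℝ (⊤ : ℕ∞) (g c)) {χ : CTree C → ℝ} (hχ : χ none = 0) (x₀ : V)
    (η : RTree C) (m : ℕ) :
    (η.alpha : ℝ) • fderiv ℝ (η.elemDiff g) x₀ (bseries g χ x₀ m) =
      ∑ τ ∈ rtreesOfSize C (η.size + m), ∑ p ∈ τ.ST with p.1 = some η,
        (if p.2.card = 1 then Triple.weight χ (τ, p) else 0) • τ.elemDiff g x₀ := by
  set N := η.size + m with hN
  -- The weights `s χ` on nonempty trees make both sides of `alpha_smul_formalEval` polynomials in
  -- `s`; the coefficients of `s` are compared.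
  let φ : ℝ → CTree C → ℝ := fun s σ => if σ = none then 1 else s * χ σ
  let I₂ : Finset (Σ _ : RTree C, CTree C × Multiset (RTree C)) :=
    (rtreesOfSize C N).sigma fun τ => τ.ST.filter fun p => p.1 = some η
  let d : Composition m ⊕ (Σ _ : RTree C, CTree C × Multiset (RTree C)) → ℕ :=
    Sum.elim (fun c => c.length) fun y => y.2.2.card
  let a : Composition m ⊕ (Σ _ : RTree C, CTree C × Multiset (RTree C)) → V :=
    Sum.elim (fun c => (η.alpha : ℝ) • (c.length.factorial : ℝ)⁻¹ •
      iteratedFDeriv ℝ c.length (η.elemDiff g) x₀ fun i => bseries g χ x₀ (c.blocksFun i))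
    fun y => -(Triple.weight χ (y.1, y.2) • y.1.elemDiff g x₀)
  have h1 : ∀ s : ℝ, ∑ i ∈ (Finset.univ : Finset (Composition m)).disjSum I₂,
      s ^ d i • a i = 0 := by
    intro s
    have h2 := alpha_smul_formalEval hg (φ := φ s) (if_pos rfl) x₀ η m
    have h3 : ∀ n, n ≠ 0 → bseries g (φ s) x₀ n = s • bseries g χ x₀ n := by
      intro n hn
      rw [bseries_eq_sum_rtreesOfSize g x₀ (Or.inr hn),
        bseries_eq_sum_rtreesOfSize g x₀ (Or.inr hn), Finset.smul_sum]
      refine Finset.sum_congr rfl fun τ _ => ?_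
      rw [smul_smul]
      congr 1
      simp only [φ, if_neg (Option.some_ne_none τ)]
      ring
    have h4 : ∀ t : Triple C, t.weight (φ s) = s ^ t.2.2.card * t.weight χ := by
      intro t
      have : t.2.2.map (fun δ => φ s (some δ)) = t.2.2.map fun δ => s * χ (some δ) := rfl
      rw [Triple.weight, Triple.weight, this, Multiset.prod_map_mul, Multiset.map_const',
        Multiset.prod_replicate]
      ring
    rw [Finset.sum_disjSum, Finset.sum_sigma]
    simp only [d, a, Sum.elim_inl, Sum.elim_inr, smul_neg, Finset.sum_neg_distrib]
    rw [← sub_eq_add_neg, sub_eq_zero]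
    simp only [h4, mul_smul] at h2
    rw [← h2, formalEval, Finset.smul_sum]
    refine Finset.sum_congr rfl fun c _ => ?_
    have h5 : (fun i => bseries g (φ s) x₀ (c.blocksFun i)) =
        fun i => s • bseries g χ x₀ (c.blocksFun i) :=
      funext fun i => h3 _ (Nat.one_le_iff_ne_zero.1 (c.one_le_blocksFun i))
    have h6 : bseries g (φ s) x₀ 0 = x₀ := by
      rw [bseries_zero, show φ s none = 1 from if_pos rfl, one_smul]
    rw [h5, h6, ContinuousMultilinearMap.map_smul_univ, Finset.prod_const, Finset.card_univ,
      Fintype.card_fin]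
    simp only [smul_smul]
    congr 1
    ring
  have h2 : (∑ c : Composition m, if c.length = 1 then (η.alpha : ℝ) •
      (c.length.factorial : ℝ)⁻¹ • iteratedFDeriv ℝ c.length (η.elemDiff g) x₀
        (fun i => bseries g χ x₀ (c.blocksFun i)) else 0) +
      ∑ τ ∈ rtreesOfSize C N, ∑ p ∈ τ.ST with p.1 = some η,
        (if p.2.card = 1 then -(Triple.weight χ (τ, p) • τ.elemDiff g x₀) else 0) = 0 := by
    have h3 := sum_eq_zero_of_isBigO (N := 1) (n := 1) _ d a
      ((Asymptotics.isBigO_zero (fun s : ℝ => s ^ (1 + 1)) (nhds 0)).congr_left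
        fun s => (h1 s).symm) le_rfl
    rw [Finset.sum_filter, Finset.sum_disjSum, Finset.sum_sigma] at h3
    exact h3
  have h3 : (∑ c : Composition m, if c.length = 1 then (η.alpha : ℝ) •
      (c.length.factorial : ℝ)⁻¹ • iteratedFDeriv ℝ c.length (η.elemDiff g) x₀
        (fun i => bseries g χ x₀ (c.blocksFun i)) else 0) =
      (η.alpha : ℝ) • fderiv ℝ (η.elemDiff g) x₀ (bseries g χ x₀ m) := by
    rcases Nat.eq_zero_or_pos m with rfl | hm
    · rw [bseries_zero, hχ, zero_smul, map_zero, smul_zero]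
      refine Finset.sum_eq_zero fun c _ => if_neg fun h => ?_
      have := c.length_le
      omega
    · rw [Finset.sum_eq_single_of_mem (Composition.single m hm) (Finset.mem_univ _)]
      · rw [if_pos (Composition.single_length hm)]
        congr 1
        have h4 : ∀ (k : ℕ) (hk : k = 1), (k.factorial : ℝ)⁻¹ •
            iteratedFDeriv ℝ k (η.elemDiff g) x₀ (fun _ => bseries g χ x₀ m) =
              fderiv ℝ (η.elemDiff g) x₀ (bseries g χ x₀ m) := by
          rintro k rfl
          simp
        rw [← h4 _ (Composition.single_length hm)]
        simp only [Composition.single_blocksFun]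
      · intro c _ hc
        exact if_neg fun h => hc ((Composition.eq_single_iff_length hm).2 h)
  rw [h3] at h2
  rw [eq_neg_of_add_eq_zero_left h2, ← Finset.sum_neg_distrib]
  refine Finset.sum_congr rfl fun τ _ => ?_
  rw [← Finset.sum_neg_distrib]
  refine Finset.sum_congr rfl fun p _ => ?_
  split_ifs <;> simp

/-- The Jacobian of `B(ψ, ·)` at `x₀`, applied to a B-series, yields the product `∗`. -/
theorem jacobianApply_bseries [Finite C] [CompleteSpace V] {g : C → V → V}
    (hg : ∀ c, ContDiff ℝ (⊤ : ℕ∞) (g c)) {χ ψ : CTree C → ℝ} (hχ : χ none = 0)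
    (hψ : ψ none = 0) (x₀ : V) :
    jacobianApply g ψ x₀ (bseries g χ x₀) = bseries g (starProd χ ψ) x₀ := by
  funext n
  rw [bseries_eq_sum_rtreesOfSize g x₀ (Or.inl (starProd_none _ _))]
  simp_rw [alpha_smul_starProd, Finset.sum_smul]
  rw [← sum_antidiagonal_ST n, jacobianApply]
  refine Finset.sum_congr rfl fun p hp => Finset.sum_congr rfl fun ϑ hϑ => ?_
  rw [← Finset.HasAntidiagonal.mem_antidiagonal.1 hp, ← mem_treesOfSize.1 hϑ]
  rcases ϑ with _ | η
  · rw [hψ, mul_zero, zero_smul]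
    refine (Finset.sum_eq_zero fun τ _ => Finset.sum_eq_zero fun q hq => ?_).symm
    rw [(Finset.mem_filter.1 hq).2, hψ, zero_mul, zero_smul]
  · rw [mul_comm, mul_smul]
    change ψ (some η) • (η.alpha : ℝ) • fderiv ℝ (η.elemDiff g) _ _ = _
    rw [alpha_smul_fderiv_bseries hg hχ, Finset.smul_sum]
    refine Finset.sum_congr rfl fun τ _ => ?_
    rw [Finset.smul_sum]
    refine Finset.sum_congr rfl fun q hq => ?_
    rw [(Finset.mem_filter.1 hq).2, smul_smul]

/-! ### The iteration in formal series -/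

theorem IsModifiedNewtonWeights.apply_none {R : Type*} [CommRing R] [Algebra ℚ R]
    {Φex Φim Φ₀ : CTree C → R} {Φk : ℕ → CTree C → R}
    (h : IsModifiedNewtonWeights Φex Φim Φ₀ Φk) (h₀ : Φ₀ none = 1) (k : ℕ) : Φk k none = 1 := by
  cases k with
  | zero => rw [h.1, h₀]
  | succ k => exact (h.2 k).1

section Formal

variable [Finite C]

theorem bseries_add (g : C → V → V) (φ ψ : CTree C → ℝ) (x₀ : V) :
    bseries g (φ + ψ) x₀ = bseries g φ x₀ + bseries g ψ x₀ := by
  funext n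
  simp [bseries, mul_add, add_smul, Finset.sum_add_distrib]

theorem bseries_sub (g : C → V → V) (φ ψ : CTree C → ℝ) (x₀ : V) :
    bseries g (φ - ψ) x₀ = bseries g φ x₀ - bseries g ψ x₀ := by
  funext n
  simp [bseries, mul_sub, sub_smul, Finset.sum_sub_distrib]

theorem isFormalNewtonStep_bseries [CompleteSpace V] {g : C → V → V}
    (hg : ∀ c, ContDiff ℝ (⊤ : ℕ∞) (g c)) {φex φim φ φ' : CTree C → ℝ} (him : φim none = 0)
    (hφ : φ none = 1) (hφ' : φ' none = 1)
    (h : ∀ τ, φ' τ = φex τ + compose φ φim τ + starProd (φ' - φ) φim τ) (x₀ : V) :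
    IsFormalNewtonStep g φex φim x₀ (bseries g φ x₀) (bseries g φ' x₀) := by
  rw [IsFormalNewtonStep, ← bseries_sub, bseriesAt_bseries hg hφ him,
    jacobianApply_bseries hg (by simp [hφ, hφ']) him, ← bseries_add, ← bseries_add]
  congr 1
  exact funext h

/-- As `φ(∅) = 0`, the Jacobian of `B(φ, ·)` raises the degree. -/
theorem jacobianApply_congr (g : C → V → V) {φ : CTree C → ℝ} (hφ : φ none = 0) (x₀ : V)
    {U U' : ℕ → V} {n : ℕ} (h : ∀ k < n, U k = U' k) :
    jacobianApply g φ x₀ U n = jacobianApply g φ x₀ U' n := by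
  refine Finset.sum_congr rfl fun p hp => Finset.sum_congr rfl fun τ hτ => ?_
  rcases τ with _ | τ
  · simp [hφ]
  · rw [h]
    have h1 := Finset.HasAntidiagonal.mem_antidiagonal.1 hp
    have h2 : τ.size = p.1 := mem_treesOfSize.1 hτ
    have := τ.size_pos
    omega

theorem IsFormalNewtonStep.unique {g : C → V → V} {φex φim : CTree C → ℝ} (him : φim none = 0)
    {x₀ : V} {Y U U' : ℕ → V} (h : IsFormalNewtonStep g φex φim x₀ Y U)
    (h' : IsFormalNewtonStep g φex φim x₀ Y U') : U = U' := by
  funext n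
  induction n using Nat.strong_induction_on with
  | _ n ih =>
    have e := congrFun h n
    have e' := congrFun h' n
    rw [Pi.add_apply] at e e'
    rw [e, e', jacobianApply_congr g him x₀ (U := U - Y) (U' := U' - Y) fun k hk => by
      rw [Pi.sub_apply, Pi.sub_apply, ih k hk]]

/-- The formal iteration has exactly one solution, given by the B-series of the weights. -/
theorem formalNewton_iff [CompleteSpace V] {g : C → V → V}
    (hg : ∀ c, ContDiff ℝ (⊤ : ℕ∞) (g c)) {φex φim φ₀ : CTree C → ℝ} {φk : ℕ → CTree C → ℝ}
    (him : φim none = 0) (h₀ : φ₀ none = 1) (h : IsModifiedNewtonWeights φex φim φ₀ φk) (x₀ : V)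
    (Y : ℕ → ℕ → V) :
    (Y 0 = bseries g φ₀ x₀ ∧ ∀ k, IsFormalNewtonStep g φex φim x₀ (Y k) (Y (k + 1))) ↔
      ∀ k, Y k = bseries g (φk k) x₀ := by
  have hstep : ∀ k, IsFormalNewtonStep g φex φim x₀ (bseries g (φk k) x₀)
      (bseries g (φk (k + 1)) x₀) := fun k =>
    isFormalNewtonStep_bseries hg him (h.apply_none h₀ k) (h.2 k).1 (h.2 k).2 x₀
  constructor
  · rintro ⟨hY0, hY⟩ k
    induction k with
    | zero => rw [hY0, h.1]
    | succ k ih =>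
      have := hY k
      rw [ih] at this
      exact this.unique him (hstep k)
  · intro hY
    refine ⟨by rw [hY 0, h.1], fun k => ?_⟩
    rw [hY k, hY (k + 1)]
    exact hstep k

end Formal

/-! ### Convergent B-series -/

/-- Grouping the terms of a sum by the finite fibres `s b` of a map `d`. -/
theorem hasSum_fiberwise {α β M : Type*} [AddCommGroup M] [TopologicalSpace M]
    [IsTopologicalAddGroup M] {f : α → M} {a : M} (d : α → β) (s : β → Finset α)
    (hs : ∀ x b, x ∈ s b ↔ d x = b) (h : HasSum f a) : HasSum (fun b => ∑ x ∈ s b, f x) a := by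
  refine HasSum.sigma ((Equiv.sigmaFiberEquiv d).hasSum_iff.2 h) fun b => ?_
  let _ : Fintype {x // d x = b} := Fintype.subtype (s b) fun x => hs x b
  rw [Finset.sum_subtype (s b) (fun x => hs x b) f]
  exact hasSum_fintype _

theorem summable_norm_sum_fiberwise {α β M : Type*} [SeminormedAddCommGroup M] {f : α → M}
    (d : α → β) (s : β → Finset α) (hs : ∀ x b, x ∈ s b ↔ d x = b)
    (h : Summable fun x => ‖f x‖) : (Summable fun b => ‖∑ x ∈ s b, f x‖) ∧
      ∑' b, ‖∑ x ∈ s b, f x‖ ≤ ∑' x, ‖f x‖ := by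
  have h1 := hasSum_fiberwise d s hs h.hasSum
  have h2 : ∀ b, ‖∑ x ∈ s b, f x‖ ≤ ∑ x ∈ s b, ‖f x‖ := fun b => norm_sum_le _ _
  have h3 := Summable.of_nonneg_of_le (fun _ => norm_nonneg _) h2 h1.summable
  refine ⟨h3, ?_⟩
  rw [← h1.tsum_eq]
  exact h3.tsum_le_tsum h2 h1.summable

section Convergent

variable [Finite C]

theorem hasSum_treesOfSize {M : Type*} [AddCommGroup M] [TopologicalSpace M]
    [IsTopologicalAddGroup M] {f : CTree C → M} {a : M} (h : HasSum f a) :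
    HasSum (fun n => ∑ τ ∈ treesOfSize C n, f τ) a :=
  hasSum_fiberwise numVertices _ (fun _ _ => mem_treesOfSize) h

theorem hasSum_antidiagonal_treesOfSize {M : Type*} [AddCommGroup M] [TopologicalSpace M]
    [IsTopologicalAddGroup M] {f : CTree C × ℕ → M} {a : M} (h : HasSum f a) :
    HasSum (fun n => ∑ p ∈ Finset.HasAntidiagonal.antidiagonal n,
      ∑ τ ∈ treesOfSize C p.1, f (τ, p.2)) a := by
  have h1 := hasSum_fiberwise (fun x : CTree C × ℕ => (numVertices x.1, x.2))
    (fun p : ℕ × ℕ => treesOfSize C p.1 ×ˢ {p.2}) (by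
      rintro ⟨τ, m⟩ ⟨b, b'⟩
      simpa [mem_treesOfSize] using fun _ => eq_comm) h
  have h2 := hasSum_fiberwise (fun p : ℕ × ℕ => p.1 + p.2) Finset.HasAntidiagonal.antidiagonal
    (fun _ _ => Finset.HasAntidiagonal.mem_antidiagonal) h1
  simpa only [Finset.sum_product, Finset.sum_singleton] using h2

theorem hasSum_bseries {g : C → V → V} {φ : CTree C → ℝ} {x₀ y : V}
    (h : HasSum (bterm g φ x₀) y) : HasSum (bseries g φ x₀) y := hasSum_treesOfSize h

theorem summable_norm_bseries [FiniteDimensional ℝ V] {g : C → V → V} {φ : CTree C → ℝ} {x₀ : V}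
    (h : Summable (bterm g φ x₀)) : Summable fun n => ‖bseries g φ x₀ n‖ :=
  (summable_norm_sum_fiberwise numVertices (treesOfSize C) (fun _ _ => mem_treesOfSize)
    h.norm).1

theorem hasSum_jacobianApply [FiniteDimensional ℝ V] {g : C → V → V} {φ : CTree C → ℝ} {x₀ v : V}
    {U : ℕ → V} (hJ : Summable (jterm g φ x₀)) (hU : Summable fun n => ‖U n‖) (hv : HasSum U v) :
    HasSum (jacobianApply g φ x₀ U) ((∑' τ, jterm g φ x₀ τ) v) := by
  have : CompleteSpace V := FiniteDimensional.complete ℝ V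
  have h1 : Summable fun x : CTree C × ℕ => ‖jterm g φ x₀ x.1‖ * ‖U x.2‖ :=
    Summable.mul_of_nonneg (f := fun τ => ‖jterm g φ x₀ τ‖) (g := fun n => ‖U n‖) hJ.norm hU
      (fun _ => norm_nonneg _) fun _ => norm_nonneg _
  have h2 : Summable fun x : CTree C × ℕ => jterm g φ x₀ x.1 (U x.2) :=
    Summable.of_norm_bounded h1 fun x => (jterm g φ x₀ x.1).le_opNorm _
  have h3 := h2.hasSum.prod_fiberwise fun τ => hv.mapL (jterm g φ x₀ τ)
  have h4 : HasSum (fun τ => jterm g φ x₀ τ v) ((∑' τ, jterm g φ x₀ τ) v) :=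
    hJ.hasSum.mapL (ContinuousLinearMap.apply ℝ V v)
  rw [← h3.unique h4]
  exact hasSum_antidiagonal_treesOfSize (f := fun x => jterm g φ x₀ x.1 (U x.2)) h2.hasSum

/-- If `B(ψ, y)` converges absolutely when expanded at `x₀`, for `y = B(φ, x₀)`, its value is the
sum of the coefficients of the formal series `B(ψ, B(φ, x₀))`. -/
theorem hasSum_bseriesAt [FiniteDimensional ℝ V] {g : C → V → V} {φ ψ : CTree C → ℝ}
    (hφ : φ none = 1) {x₀ y : V} (hy : HasSum (bterm g φ x₀) y)
    (htaylor : ∀ ϑ, ψ ϑ ≠ 0 → HasSum (fun κ : ℕ => ((κ.factorial : ℝ))⁻¹ •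
      iteratedFDeriv ℝ κ (elemDiff g ϑ) x₀ fun _ => y - x₀) (elemDiff g ϑ y))
    (hcomp : Summable fun p : CTree C × ℕ =>
      |(alpha p.1 : ℝ) * ψ p.1| * ((p.2.factorial : ℝ))⁻¹ *
        ‖iteratedFDeriv ℝ p.2 (elemDiff g p.1) x₀‖ *
          (∑' σ : RTree C, ‖bterm g φ x₀ (some σ)‖) ^ p.2) :
    HasSum (bseriesAt g ψ (bseries g φ x₀)) (∑' τ, bterm g ψ y τ) := by
  have : CompleteSpace V := FiniteDimensional.complete ℝ V
  set Y := bseries g φ x₀ with hY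
  set ρ := ∑' σ : RTree C, ‖bterm g φ x₀ (some σ)‖ with hρ
  -- the formal series of the increment `y - x₀`
  let Z : ℕ → V := fun n => ∑ τ ∈ rtreesOfSize C n, bterm g φ x₀ (some τ)
  have hY0 : Y 0 = x₀ := by rw [hY, bseries_zero, hφ, one_smul]
  have hZY : ∀ n, n ≠ 0 → Z n = Y n := fun n hn =>
    (bseries_eq_sum_rtreesOfSize g x₀ (Or.inr hn)).symm
  have hZ0 : Z 0 = 0 := Finset.sum_eq_zero fun τ hτ =>
    absurd (mem_rtreesOfSize.1 hτ) τ.size_pos.ne'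
  obtain ⟨hZs, hZρ⟩ := summable_norm_sum_fiberwise RTree.size (rtreesOfSize C)
    (fun _ _ => mem_rtreesOfSize) (hy.summable.norm.comp_injective (Option.some_injective _))
  have hZsum : ∑' n, Z n = y - x₀ := by
    have h1 := (hasSum_bseries hy).sub (hasSum_ite_eq 0 x₀)
    refine HasSum.tsum_eq (h1.congr_fun fun n => ?_)
    by_cases hn : n = 0
    · subst hn
      rw [if_pos rfl, hZ0, ← hY, hY0, sub_self]
    · rw [if_neg hn, sub_zero, hZY n hn]
  let p : CTree C → FormalMultilinearSeries ℝ V V := fun ϑ κ =>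
    ((alpha ϑ : ℝ) * ψ ϑ) • taylorSeries (elemDiff g ϑ) x₀ κ
  let B : CTree C × ℕ → ℝ := fun x => |(alpha x.1 : ℝ) * ψ x.1| * ((x.2.factorial : ℝ))⁻¹ *
    ‖iteratedFDeriv ℝ x.2 (elemDiff g x.1) x₀‖ * ρ ^ x.2
  have hB : Summable B := hcomp
  have hpB : ∀ ϑ κ, ‖p ϑ κ‖ * (∑' n, ‖Z n‖) ^ κ ≤ B (ϑ, κ) := by
    intro ϑ κ
    have h1 : ‖p ϑ κ‖ = |(alpha ϑ : ℝ) * ψ ϑ| * ((κ.factorial : ℝ))⁻¹ *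
        ‖iteratedFDeriv ℝ κ (elemDiff g ϑ) x₀‖ := by
      simp only [p, taylorSeries, norm_smul, norm_inv, Real.norm_natCast]
      rw [Real.norm_eq_abs, mul_assoc]
    rw [h1]
    exact mul_le_mul_of_nonneg_left (pow_le_pow_left₀ (tsum_nonneg fun _ => norm_nonneg _) hZρ κ)
      (by positivity)
  have hBϑ : ∀ ϑ, Summable fun κ => B (ϑ, κ) := fun ϑ => hB.prod_factor ϑ
  have hpS : ∀ ϑ, Summable fun κ => ‖p ϑ κ‖ * (∑' n, ‖Z n‖) ^ κ := fun ϑ =>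
    Summable.of_nonneg_of_le (fun κ => mul_nonneg (norm_nonneg _)
      (pow_nonneg (tsum_nonneg fun _ => norm_nonneg _) _)) (hpB ϑ) (hBϑ ϑ)
  have hcoef : ∀ ϑ, substCoeff (p ϑ) Z =
      fun m => ((alpha ϑ : ℝ) * ψ ϑ) • formalEval (elemDiff g ϑ) Y m := by
    intro ϑ
    rw [formalEval_eq_substCoeff _ Y Z hZY, hY0]
    funext m
    simp only [substCoeff, p, Finset.smul_sum]
    rfl
  have hval : ∀ ϑ, ∑' κ, p ϑ κ (fun _ => ∑' n, Z n) = bterm g ψ y ϑ := by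
    intro ϑ
    rw [hZsum]
    by_cases h : ψ ϑ = 0
    · -- nothing is known about `F(ϑ)` at `y`, but the factor `ψ ϑ` vanishes
      simp only [p, h, mul_zero, zero_smul, bterm]
      exact tsum_zero
    · exact ((htaylor ϑ h).const_smul ((alpha ϑ : ℝ) * ψ ϑ)).tsum_eq
  let e : CTree C × ℕ → V := fun x =>
    ((alpha x.1 : ℝ) * ψ x.1) • formalEval (elemDiff g x.1) Y x.2
  have hsub : ∀ ϑ, HasSum (fun m => e (ϑ, m)) (bterm g ψ y ϑ) ∧
      (Summable fun m => ‖e (ϑ, m)‖) ∧ ∑' m, ‖e (ϑ, m)‖ ≤ ∑' κ, B (ϑ, κ) := by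
    intro ϑ
    have h1 := hasSum_substCoeff (p ϑ) hZ0 hZs (hpS ϑ)
    rw [hval, hcoef] at h1
    exact ⟨h1.1, h1.2.1, h1.2.2.trans ((hpS ϑ).tsum_le_tsum (hpB ϑ) (hBϑ ϑ))⟩
  have he : Summable fun x => ‖e x‖ := by
    refine (summable_prod_of_nonneg fun _ => norm_nonneg _).2 ⟨fun ϑ => (hsub ϑ).2.1, ?_⟩
    exact Summable.of_nonneg_of_le (fun _ => tsum_nonneg fun _ => norm_nonneg _)
      (fun ϑ => (hsub ϑ).2.2) hB.prod
  have h1 := he.of_norm.hasSum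
  have h2 := h1.prod_fiberwise fun ϑ => (hsub ϑ).1
  rw [h2.tsum_eq]
  exact hasSum_antidiagonal_treesOfSize (f := e) h1

/-- The sum of the B-series of the new weights solves the linear equation for the new iterate. -/
theorem hasSum_newtonStep [FiniteDimensional ℝ V] {g : C → V → V}
    (hg : ∀ c, ContDiff ℝ (⊤ : ℕ∞) (g c)) {φex φim φ φ' : CTree C → ℝ} (him : φim none = 0)
    (hφ : φ none = 1) (hφ' : φ' none = 1)
    (h : ∀ τ, φ' τ = φex τ + compose φ φim τ + starProd (φ' - φ) φim τ) {x₀ y y' : V}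
    (hy : HasSum (bterm g φ x₀) y) (hc : ConvergentStep g φex φim φ φ' x₀ y)
    (hs : IsNewtonStep g φex φim x₀ y y') : HasSum (bterm g φ' x₀) y' := by
  have : CompleteSpace V := FiniteDimensional.complete ℝ V
  obtain ⟨z, hz⟩ := hc.next
  have hz' := hasSum_bseries hz
  have hy' := hasSum_bseries hy
  have h1 := hasSum_bseries hc.explicit_part.hasSum
  have h2 := hasSum_bseriesAt hφ hy hc.taylor hc.composite
  have hU : Summable fun n => ‖(bseries g φ' x₀ - bseries g φ x₀) n‖ :=
    Summable.of_nonneg_of_le (fun _ => norm_nonneg _) (fun n => norm_sub_le _ _)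
      ((summable_norm_bseries hc.next).add (summable_norm_bseries hc.current))
  have h3 := hasSum_jacobianApply hc.jacobian hU (hz'.sub hy')
  have h4 := (h1.add h2).add h3
  have h5 := isFormalNewtonStep_bseries hg him hφ hφ' h x₀
  have h6 : z = ∑' τ, bterm g φex x₀ τ + ∑' τ, bterm g φim y τ +
      (∑' τ, jterm g φim x₀ τ) (z - y) := by
    refine hz'.unique ?_
    rw [h5]
    exact h4
  -- the difference of the two solutions is a fixed point of the Jacobian
  have h7 : (∑' τ, jterm g φim x₀ τ) (z - y') = z - y' := by
    have h8 : z - y' = (∑' τ, jterm g φim x₀ τ) (z - y) - (∑' τ, jterm g φim x₀ τ) (y' - y) := by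
      conv_lhs => rw [h6, hs]
      abel
    have h9 : (∑' τ, jterm g φim x₀ τ) (z - y') =
        (∑' τ, jterm g φim x₀ τ) (z - y) - (∑' τ, jterm g φim x₀ τ) (y' - y) := by
      rw [← map_sub, sub_sub_sub_cancel_right]
    exact h9.trans h8.symm
  have h8 := hc.unique_solution _ h7
  rw [sub_eq_zero] at h8
  rwa [← h8]

end Convergent

end BSeries

open BSeries
theorem mainTheorem2 {d m : ℕ} {Ω : Type*} [MeasurableSpace Ω]
    (g : Fin (m + 1) → EuclideanSpace ℝ (Fin d) → EuclideanSpace ℝ (Fin d))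
    (hg : ∀ l, ContDiff ℝ (⊤ : ℕ∞) (g l)) (x₀ : EuclideanSpace ℝ (Fin d))
    (Φex Φim Φ₀ : CTree (Fin (m + 1)) → Xi Ω)
    (hex : Φex none = 1) (him : Φim none = 0) (h₀ : Φ₀ none = 1) :
    -- the recursions determine the weights of the iterates and of the method
    (∃! Φk, IsModifiedNewtonWeights Φex Φim Φ₀ Φk) ∧
    (∃! Φ, IsMethodWeights Φex Φim Φ) ∧
    (∀ Φk, IsModifiedNewtonWeights Φex Φim Φ₀ Φk →
      -- the formal iterates are the B-series with these weights
      (∀ (h : ℝ≥0) (ω : Ω) (Y : ℕ → ℕ → EuclideanSpace ℝ (Fin d)),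
        (Y 0 = bseries g (path Φ₀ h ω) x₀ ∧
          ∀ k, IsFormalNewtonStep g (path Φex h ω) (path Φim h ω) x₀ (Y k) (Y (k + 1))) ↔
        ∀ k, Y k = bseries g (path (Φk k) h ω) x₀) ∧
      -- the iterates are the sums of these B-series if all series converge
      (∀ (h : ℝ≥0) (ω : Ω) (K : ℕ) (y : ℕ → EuclideanSpace ℝ (Fin d)),
        HasSum (bterm g (path Φ₀ h ω) x₀) (y 0) →
        (∀ k < K, IsNewtonStep g (path Φex h ω) (path Φim h ω) x₀ (y k) (y (k + 1)) ∧
          ConvergentStep g (path Φex h ω) (path Φim h ω) (path (Φk k) h ω)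
            (path (Φk (k + 1)) h ω) x₀ (y k)) →
        ∀ k ≤ K, HasSum (bterm g (path (Φk k) h ω) x₀) (y k)) ∧
      -- `ram` is a growth function, also for each fixed step size and outcome
      (∀ Φ, IsMethodWeights Φex Φim Φ →
        IsGrowthFunction ram Φk Φ ∧
        ∀ (h : ℝ≥0) (ω : Ω),
          IsGrowthFunction ram (fun k => path (Φk k) h ω) (path Φ h ω))) ∧
    -- `ram` is sharp in general
    (∃ (Ψex Ψim Ψ₀ Ψ : CTree (Fin (m + 1)) → Xi Ω) (Ψk : ℕ → CTree (Fin (m + 1)) → Xi Ω),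
      Ψex none = 1 ∧ Ψim none = 0 ∧ Ψ₀ none = 1 ∧
      IsModifiedNewtonWeights Ψex Ψim Ψ₀ Ψk ∧ IsMethodWeights Ψex Ψim Ψ ∧
      ∀ τ k, k < ram τ → ∀ (h : ℝ≥0) (ω : Ω), 0 < h → path (Ψk k) h ω τ ≠ path Ψ h ω τ) ∧
    -- `ram` is one plus the maximal number of ramifications along a branch
    (∀ τ : RTree (Fin (m + 1)),
      IsGreatest {n | ∃ b, IsBranch τ b ∧ n = 1 + ramifications b} (ram (some τ))) := by
  have hpath : ∀ (h : ℝ≥0) (ω : Ω) Φk, IsModifiedNewtonWeights Φex Φim Φ₀ Φk →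
      IsModifiedNewtonWeights (path Φex h ω) (path Φim h ω) (path Φ₀ h ω)
        fun k => path (Φk k) h ω := fun h ω Φk hk => hk.map (evalXi h ω)
  have him' : ∀ (h : ℝ≥0) (ω : Ω), path Φim h ω none = 0 := fun h ω => by
    rw [path_eq_comp, Function.comp_apply, him, map_zero]
  have h₀' : ∀ (h : ℝ≥0) (ω : Ω), path Φ₀ h ω none = 1 := fun h ω => by
    rw [path_eq_comp, Function.comp_apply, h₀, map_one]
  refine ⟨existsUnique_modifiedNewtonWeights hex him Φ₀, existsUnique_methodWeights hex him,
    fun Φk hk => ⟨fun h ω Y => ?_, fun h ω K y hy0 hstep => ?_, fun Φ hΦ => ⟨?_, fun h ω => ?_⟩⟩,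
    ?_, fun τ => isGreatest_ramifications τ⟩
  · exact formalNewton_iff hg (him' h ω) (h₀' h ω) (hpath h ω Φk hk) x₀ Y
  · have hk' := hpath h ω Φk hk
    intro k hkK
    induction k with
    | zero =>
      have e : path (Φk 0) h ω = path Φ₀ h ω := hk'.1
      rwa [e]
    | succ k ih =>
      obtain ⟨h1, h2⟩ := hstep k hkK
      exact hasSum_newtonStep hg (him' h ω) (hk'.apply_none (h₀' h ω) k) (hk'.2 k).1 (hk'.2 k).2
        (ih (Nat.le_of_succ_le hkK)) h2 h1
  · exact isGrowthFunction_ram him hk hΦ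
  · exact isGrowthFunction_ram (him' h ω) (hpath h ω Φk hk) (hΦ.map (evalXi h ω))
  · -- the implicit Euler method, started at the constant predictor
    have hu : unitWeight (Xi Ω) (none : CTree (Fin (m + 1))) = 1 := if_pos rfl
    have he : eulerWeight (Xi Ω) (none : CTree (Fin (m + 1))) = 0 := if_neg (by simp [numVertices])
    obtain ⟨Ψk, hΨk, -⟩ := existsUnique_modifiedNewtonWeights hu he (unitWeight (Xi Ω))
    obtain ⟨Ψ, hΨ, -⟩ := existsUnique_methodWeights hu he
    refine ⟨_, _, _, Ψ, Ψk, hu, he, hu, hΨk, hΨ, ?_⟩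
    rintro (_ | τ) k hk h ω -
    · exact absurd hk (Nat.not_lt_zero k)
    · rw [path_eq_comp, path_eq_comp, Function.comp_apply, Function.comp_apply,
        newtonWeights_euler hΨk τ hk, methodWeights_euler hΨ τ, map_zero, map_one]
      exact zero_ne_one
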